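/- **Setting.** Let $N\ge 1$ and let $\mathbf G=(\mathbf V,\mathbf E)$ be a directed graph on $\mathbf V=\{1,\dots,N\}$ without self-loops and weakly connected. Put $\mathbf V_i=\{j:(j,i)\in\mathbf E\}$ and let $p_i$, $q_i$ be the in-degree and out-degree of $i$. Let $\rho:[0,\infty)\to\Gamma=[\rho^{\min},\rho^{\max}]$ be continuously differentiable, $A(\rho)=A_0+\rho\Delta$ with constant $n\times n$ matrices $A_0,\Delta$, and consider the leader and the $N$ agents $$\dot x=A(\rho(t))x+B_{20}w_0,\quad x(0)=x_0,\qquad \dot x_i=A(\rho(t))x_i+u_i+B_{2i}w_i,\quad x_i(0)=x_{i0},$$ with signals $y_i=C_{2i}x+D_{2i}w_i$, $v_{ij}=H_{ij}x_j+G_{ij}w_{ij}$, disturbances $w_0,w_i,w_{ij}\in L_2[0,\infty)$, $E_{2i}=D_{2i}D_{2i}'>0$ and $F_{ij}=G_{ij}G_{ij}'>0$ for $j\in\mathbf V_i$, and the protocol $$u_i=L_i(\rho(t))(y_i-C_{2i}x_i)+\sum_{j\in\mathbf V_i}K_{ij}(\rho(t))(v_{ij}-H_{ij}x_i).$$ Let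 $e_i=x-x_i$, $\mathbf e=[e_1'\dots e_N']'$, $\Psi_{\mathbf G}(\mathbf e)=\frac1N\sum_i\sum_{j\in\mathbf V_i}\|e_j-e_i\|^2$, and, for a symmetric $P>0$, $\|(\mathbf x_0,w_0,\mathbf w,\bar{\mathbf w})\|^2=\mathbf e(0)'P\mathbf e(0)+\|w_0\|_2^2+\frac1N\sum_i\big(\|w_i\|_2^2+\sum_{j=1}^N\|w_{ij}\|_2^2\big)$. For $\gamma>0$, gain schedules $L_i,K_{ij}$ solve the *weak robust synchronization problem* (with the matrix $P$) if they are continuous on $\Gamma$ and: (i) when all disturbances are zero, the error dynamics are exponentially stable, i.e. there are $c,\omega>0$, common to all initial states, with $\|e_i(t)\|^2\le c\,\|\mathbf e(0)\|^2e^{-\omega t}$ for all $i$ and $t\ge0$; (ii) $\int_0^\infty\Psi_{\mathbf G}(\mathbf e(t))\,dt\,/\,\|(\mathbf x_0,w_0,\mathbf w,\bar{\mathbf w})\|^2\le\gamma^2$ for all inputs of nonzero norm; (iii) $\sum_i\|e_i(t)\|^2\to0$ as $t\to\infty$ for all $L_2$ disturbances. They solve the *strong robust synchronization problem* with $Q$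 if the same holds with $\Psi_{\mathbf G}(\mathbf e)$ in (ii) replaced by $\frac1N\mathbf e'Q\mathbf e+\Psi_{\mathbf G}(\mathbf e)$. **Grid and matrix inequalities.** Let $\alpha,\gamma,\delta_i>0$ and $Q_i=Q_i'>0$ be given and $Q=\mathrm{diag}[Q_1,\dots,Q_N]$. Let $\rho^1<\dots<\rho^M$, $M\ge2$, be grid points with $\rho^1\le\rho^{\min}$, $\rho^M\ge\rho^{\max}$ and $|\rho^k-\rho^{k+1}|<\alpha/\sigma(\Delta)$, where $\sigma(\Delta)$ is the largest singular value of $\Delta$ (no restriction on the spacing if $\Delta=0$). Suppose that for every $k$ the scalars $\theta_{i,k}>0$ and the matrices $X_{i,k}=X_{i,k}'>0$, $i=1,\dots,N$, satisfy the coupled linear matrix inequalities (in $\theta_i=\theta_{i,k}$, $X_i=X_{i,k}$, with $\rho=\rho^k$) $$\begin{bmatrix}S_i(\rho)+\theta_i\alpha^2I&T_i&X_i\\T_i'&-\Upsilon_i&0\\X_i&0&-\theta_iI\end{bmatrix}<0,\qquad i=1,\dots,N,$$ where, with $\tilde A_i=A(\rho)+\delta_iI+B_{2i}D_{2i}'E_{2i}^{-1}C_{2i}$,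 $$S_i(\rho)=X_i\tilde A_i+\tilde A_i'X_i+(p_i+q_i)I-\gamma^2C_{2i}'E_{2i}^{-1}C_{2i}-\gamma^2\sum_{j\in\mathbf V_i}H_{ij}'F_{ij}^{-1}H_{ij}+Q_i,$$ $$T_i=\big[X_iB_{20}\;\;X_iB_{2i}(I-D_{2i}'E_{2i}^{-1}D_{2i})\;\;\Xi_i\big],\qquad \Upsilon_i=\mathrm{diag}[\gamma^2I,\gamma^2I,Z_i],$$ $\Xi_i$ is the row of the blocks $\gamma^2H_{ij}'F_{ij}^{-1}H_{ij}-I$, $j\in\mathbf V_i$, and $Z_i$ is the block diagonal matrix of the blocks $\frac{2\delta_j}{q_j+1}X_j$, $j\in\mathbf V_i$. For $\rho\in[\rho^k,\rho^{k+1}]$ put $$X_{i,\rho}=\frac{\rho^{k+1}-\rho}{\rho^{k+1}-\rho^k}X_{i,k}+\frac{\rho-\rho^k}{\rho^{k+1}-\rho^k}X_{i,k+1},$$ $$K_{ij}(\rho)=\gamma^2X_{i,\rho}^{-1}H_{ij}'F_{ij}^{-1},\qquad L_i(\rho)=(\gamma^2X_{i,\rho}^{-1}C_{2i}'-B_{2i}D_{2i}')E_{2i}^{-1}.$$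 **Theorem.** Let $\bar r=\min_i\Big\{\lambda_{\min}(Q_i)\Big[\sup_k\frac{\|X_{i,k+1}-X_{i,k}\|}{\rho^{k+1}-\rho^k}\Big]^{-1}\Big\}\in[0,\infty]$, where $\|\cdot\|$ is the spectral norm. (a) If $\sup_{t\ge0}|\dot\rho(t)|\le\bar r$, then the gain schedules $L_i,K_{ij}$ solve the weak robust synchronization problem. (b) If $\sup_{t\ge0}|\dot\rho(t)|\le\eta\,\bar r$ for some $\eta\in[0,1)$ (with the convention $0\cdot\infty=0$), then they solve the strong robust synchronization problem with $Q$ replaced by $(1-\eta)Q$. In both cases the matrix $P$ is $P=\mathrm{diag}\big[\frac1{\gamma^2N}X_{i,\rho(0)}\big]$. -/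

import Mathlib

open Matrix MeasureTheory Filter Topology
open scoped ENNReal

noncomputable section

/-! ### Vectors, norms, differential equations

Vectors of `ℝᵏ` are functions `Fin k → ℝ`; the square of the Euclidean norm is `v ⬝ᵥ v`. -/

/-- Square of the Euclidean norm, `‖v‖² = v'v`. -/
def normSq {ι : Type*} [Fintype ι] (v : ι → ℝ) : ℝ := v ⬝ᵥ v

/-- `w ∈ L₂[0,∞)` for a vector signal `w`: every component is square integrable on `[0,∞)`. -/
def IsL2 {ι : Type*} (w : ℝ → ι → ℝ) : Prop :=
  ∀ a, MemLp (fun t => w t a) 2 (volume.restrict (Set.Ici 0))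

/-- `‖w‖₂² = ∫₀^∞ ‖w(t)‖² dt`. -/
def l2NormSq {ι : Type*} [Fintype ι] (w : ℝ → ι → ℝ) : ℝ :=
  ∫ t in Set.Ici (0 : ℝ), normSq (w t)

/-- `x` is a (Carathéodory) solution on `[0,∞)` of `dx/dt = f(t)`, `x(0) = x₀`: it is the
indefinite integral of the locally integrable function `f`. The right-hand side `f(t)` is evaluated
along the trajectories of the system under consideration. -/
def SolvesIVP {n : ℕ} (f : ℝ → Fin n → ℝ) (x₀ : Fin n → ℝ) (x : ℝ → Fin n → ℝ) : Prop :=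
  ∀ t, 0 ≤ t → IntervalIntegrable f volume 0 t ∧ x t = x₀ + ∫ s in (0 : ℝ)..t, f s

/-- Smallest eigenvalue of a real symmetric matrix (its spectrum is the finite set of its
eigenvalues). -/
def lambdaMin {n : ℕ} (A : Matrix (Fin n) (Fin n) ℝ) : ℝ := sInf (spectrum ℝ A)

/-- Spectral norm of a square matrix (the operator norm induced by the Euclidean norm), which is
its largest singular value. -/
def specNorm {n : ℕ} (A : Matrix (Fin n) (Fin n) ℝ) : ℝ :=
  ‖Matrix.toEuclideanCLM (𝕜 := ℝ) A‖

/-! ### The network -/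

/-- Data of a network of `N` single-input bilinear agents with states in `ℝⁿ`. -/
structure BilinearNetwork (N n : ℕ) where
  /-- communication graph; `graph.Adj j i` means that `(j,i)` is an edge, from `j` to `i` -/
  graph : Digraph (Fin N)
  /-- dimension of `w₀` -/
  r₀ : ℕ
  /-- dimension of `wᵢ` -/
  r : Fin N → ℕ
  /-- dimension of `yᵢ` -/
  m : Fin N → ℕ
  /-- dimension of `w_{ij}` -/
  s : Fin N → Fin N → ℕ
  /-- dimension of `v_{ij}` -/
  l : Fin N → Fin N → ℕ
  A₀ : Matrix (Fin n) (Fin n) ℝ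
  Δ : Matrix (Fin n) (Fin n) ℝ
  B₂₀ : Matrix (Fin n) (Fin r₀) ℝ
  B₂ : ∀ i, Matrix (Fin n) (Fin (r i)) ℝ
  C₂ : ∀ i, Matrix (Fin (m i)) (Fin n) ℝ
  D₂ : ∀ i, Matrix (Fin (m i)) (Fin (r i)) ℝ
  H : ∀ i j, Matrix (Fin (l i j)) (Fin n) ℝ
  G : ∀ i j, Matrix (Fin (l i j)) (Fin (s i j)) ℝ

namespace BilinearNetwork

variable {N n : ℕ} (net : BilinearNetwork N n)

/-- `A(ρ) = A₀ + ρ Δ`. -/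
def A (ρ : ℝ) : Matrix (Fin n) (Fin n) ℝ := net.A₀ + ρ • net.Δ

/-- `E₂ᵢ = D₂ᵢ D₂ᵢ'`. -/
def E₂ (i : Fin N) : Matrix (Fin (net.m i)) (Fin (net.m i)) ℝ := net.D₂ i * (net.D₂ i)ᵀ

/-- `F_{ij} = G_{ij} G_{ij}'`. -/
def F (i j : Fin N) : Matrix (Fin (net.l i j)) (Fin (net.l i j)) ℝ := net.G i j * (net.G i j)ᵀ

open Classical in
/-- Neighbourhood `Vᵢ = {j : (j,i) ∈ E}`. -/
def nbrs (i : Fin N) : Finset (Fin N) := Finset.univ.filter fun j => net.graph.Adj j i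

/-- In-degree `pᵢ`. -/
def inDeg (i : Fin N) : ℕ := (net.nbrs i).card

open Classical in
/-- Out-degree `qᵢ`. -/
def outDeg (i : Fin N) : ℕ := (Finset.univ.filter fun j => net.graph.Adj i j).card

/-- The disagreement function `Ψ(x) = (1/N) ∑ᵢ ∑_{j ∈ Vᵢ} ‖xⱼ - xᵢ‖²`. -/
def disagreement (z : Fin N → Fin n → ℝ) : ℝ :=
  (1 / (N : ℝ)) * ∑ i, ∑ j ∈ net.nbrs i, normSq (z j - z i)

/-! ### Trajectories of the closed loop -/

/-- Gains `Lᵢ(ρ)`. -/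
abbrev ObserverGains : Type := ∀ i : Fin N, ℝ → Matrix (Fin n) (Fin (net.m i)) ℝ

/-- Gains `K_{ij}(ρ)`. -/
abbrev InterconnectionGains : Type := ∀ i j : Fin N, ℝ → Matrix (Fin n) (Fin (net.l i j)) ℝ

/-- A disturbance `(w₀, (wᵢ), (w_{ij}))`. -/
structure Disturbance where
  w₀ : ℝ → Fin net.r₀ → ℝ
  w : ∀ i, ℝ → Fin (net.r i) → ℝ
  wbar : ∀ i j, ℝ → Fin (net.s i j) → ℝ

variable {net}

/-- All components of the disturbance are in `L₂[0,∞)`. -/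
def Disturbance.InL2 (d : net.Disturbance) : Prop :=
  IsL2 d.w₀ ∧ (∀ i, IsL2 (d.w i)) ∧ ∀ i j, IsL2 (d.wbar i j)

variable (net)

/-- The zero disturbance. -/
def noDisturbance : net.Disturbance where
  w₀ := fun _ _ => 0
  w := fun _ _ _ => 0
  wbar := fun _ _ _ _ => 0

/-- Broadcast signal `yᵢ = C₂ᵢ x + D₂ᵢ wᵢ`. -/
def y (d : net.Disturbance) (x : ℝ → Fin n → ℝ) (i : Fin N) (t : ℝ) : Fin (net.m i) → ℝ :=
  net.C₂ i *ᵥ x t + net.D₂ i *ᵥ d.w i t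

/-- Signal `v_{ij} = H_{ij} xⱼ + G_{ij} w_{ij}` received by agent `i` from agent `j`. -/
def v (d : net.Disturbance) (xs : Fin N → ℝ → Fin n → ℝ) (i j : Fin N) (t : ℝ) :
    Fin (net.l i j) → ℝ :=
  net.H i j *ᵥ xs j t + net.G i j *ᵥ d.wbar i j t

/-- The protocol
`uᵢ(t) = Lᵢ(ρ(t)) (yᵢ - C₂ᵢ xᵢ) + ∑_{j ∈ Vᵢ} K_{ij}(ρ(t)) (v_{ij} - H_{ij} xᵢ)`. -/
def u (ρ : ℝ → ℝ) (L : net.ObserverGains) (K : net.InterconnectionGains) (d : net.Disturbance)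
    (x : ℝ → Fin n → ℝ) (xs : Fin N → ℝ → Fin n → ℝ) (i : Fin N) (t : ℝ) : Fin n → ℝ :=
  L i (ρ t) *ᵥ (net.y d x i t - net.C₂ i *ᵥ xs i t) +
    ∑ j ∈ net.nbrs i, K i j (ρ t) *ᵥ (net.v d xs i j t - net.H i j *ᵥ xs i t)

/-- `(x, (xᵢ))` is a trajectory of the leader and of the agents equipped with the protocol, from
the initial states `x₀`, `(x_{i0})` and under the disturbance `d`. -/
def IsTrajectory (ρ : ℝ → ℝ) (L : net.ObserverGains) (K : net.InterconnectionGains)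
    (d : net.Disturbance) (x₀ : Fin n → ℝ) (xs₀ : Fin N → Fin n → ℝ)
    (x : ℝ → Fin n → ℝ) (xs : Fin N → ℝ → Fin n → ℝ) : Prop :=
  SolvesIVP (fun t => net.A (ρ t) *ᵥ x t + net.B₂₀ *ᵥ d.w₀ t) x₀ x ∧
  ∀ i, SolvesIVP
    (fun t => net.A (ρ t) *ᵥ xs i t + net.u ρ L K d x xs i t + net.B₂ i *ᵥ d.w i t)
    (xs₀ i) (xs i)

/-! ### The synchronization problems

Stacked vectors of `ℝⁿᴺ` are indexed by `Fin n × Fin N` (component, agent); a block diagonal matrix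
`diag[M₁, …, M_N]` is `Matrix.blockDiagonal M`. -/

/-- The stacked vector `[z₁' … z_N']'`. -/
def stack (z : Fin N → Fin n → ℝ) : Fin n × Fin N → ℝ := fun p => z p.2 p.1

/-- `‖z‖²_P = z'Pz`. -/
def weightedNormSq {ι : Type*} [Fintype ι] (P : Matrix ι ι ℝ) (z : ι → ℝ) : ℝ := z ⬝ᵥ P *ᵥ z

/-- `‖(x₀, w₀, w, w̄)‖² = ‖1 ⊗ x₀ - [x₁₀' … x_{N0}']'‖²_P + ‖w₀‖₂² +
(1/N) ∑ᵢ (‖wᵢ‖₂² + ∑ⱼ ‖w_{ij}‖₂²)`. -/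
def inputNormSq (P : Matrix (Fin n × Fin N) (Fin n × Fin N) ℝ) (d : net.Disturbance)
    (x₀ : Fin n → ℝ) (xs₀ : Fin N → Fin n → ℝ) : ℝ :=
  weightedNormSq P (stack fun i => x₀ - xs₀ i) + l2NormSq d.w₀ +
    (1 / (N : ℝ)) * ∑ i, (l2NormSq (d.w i) + ∑ j, l2NormSq (d.wbar i j))

/-- The gain schedules are continuous on `Γ`. -/
def ContinuousGains (Γ : Set ℝ) (L : net.ObserverGains) (K : net.InterconnectionGains) : Prop :=
  (∀ i, ContinuousOn (L i) Γ) ∧ ∀ i, ∀ j ∈ net.nbrs i, ContinuousOn (K i j) Γ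

/-- Property (i): in the absence of disturbances the synchronization error dynamics are
exponentially stable, the constants being common to all initial states. -/
def ExponentiallyStable (ρ : ℝ → ℝ) (L : net.ObserverGains) (K : net.InterconnectionGains) :
    Prop :=
  ∃ c > 0, ∃ ω > 0, ∀ x₀ xs₀ x xs, net.IsTrajectory ρ L K net.noDisturbance x₀ xs₀ x xs →
    ∀ i t, 0 ≤ t →
      normSq (x t - xs i t) ≤ c * (∑ j, normSq (x₀ - xs₀ j)) * Real.exp (-ω * t)

/-- Property (ii): for every input of nonzero norm, the ratio of the integral of the running cost
of the errors `eᵢ = x - xᵢ` to the square of the norm of the input is at most `γ²`. -/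
def HInfPerformance (ρ : ℝ → ℝ) (L : net.ObserverGains) (K : net.InterconnectionGains)
    (γ : ℝ) (P : Matrix (Fin n × Fin N) (Fin n × Fin N) ℝ)
    (cost : (Fin N → Fin n → ℝ) → ℝ) : Prop :=
  ∀ (d : net.Disturbance) x₀ xs₀ x xs, d.InL2 → net.IsTrajectory ρ L K d x₀ xs₀ x xs →
    IntegrableOn (fun t => cost fun i => x t - xs i t) (Set.Ici 0) ∧
    (net.inputNormSq P d x₀ xs₀ ≠ 0 →
      (∫ t in Set.Ici (0 : ℝ), cost fun i => x t - xs i t) / net.inputNormSq P d x₀ xs₀ ≤ γ ^ 2)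

/-- Property (iii): `∑ᵢ ‖x(t) - xᵢ(t)‖² → 0` for all disturbances in `L₂[0,∞)`. -/
def SynchronizesAsymptotically (ρ : ℝ → ℝ) (L : net.ObserverGains)
    (K : net.InterconnectionGains) : Prop :=
  ∀ (d : net.Disturbance) x₀ xs₀ x xs, d.InL2 → net.IsTrajectory ρ L K d x₀ xs₀ x xs →
    Tendsto (fun t => ∑ i, normSq (x t - xs i t)) atTop (𝓝 0)

/-- The gain schedules `L`, `K` solve the problem of weak robust synchronization, with the
weight `P` in the norm of the inputs. -/
def SolvesWeakSync (Γ : Set ℝ) (ρ : ℝ → ℝ) (L : net.ObserverGains)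
    (K : net.InterconnectionGains) (γ : ℝ)
    (P : Matrix (Fin n × Fin N) (Fin n × Fin N) ℝ) : Prop :=
  P.PosDef ∧ net.ContinuousGains Γ L K ∧ net.ExponentiallyStable ρ L K ∧
  net.HInfPerformance ρ L K γ P net.disagreement ∧ net.SynchronizesAsymptotically ρ L K

/-- The gain schedules `L`, `K` solve the problem of strong robust synchronization with the
weight `Q` of the errors, with the weight `P` in the norm of the inputs. -/
def SolvesStrongSync (Γ : Set ℝ) (ρ : ℝ → ℝ) (L : net.ObserverGains)
    (K : net.InterconnectionGains) (γ : ℝ) (Q : Matrix (Fin n × Fin N) (Fin n × Fin N) ℝ)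
    (P : Matrix (Fin n × Fin N) (Fin n × Fin N) ℝ) : Prop :=
  P.PosDef ∧ net.ContinuousGains Γ L K ∧ net.ExponentiallyStable ρ L K ∧
  net.HInfPerformance ρ L K γ P
    (fun e => (1 / (N : ℝ)) * weightedNormSq Q (stack e) + net.disagreement e) ∧
  net.SynchronizesAsymptotically ρ L K

/-! ### The coupled linear matrix inequalities -/

/-- `Sᵢ(ρ)`. -/
def lmiS (γ : ℝ) (δ : Fin N → ℝ) (Q : Fin N → Matrix (Fin n) (Fin n) ℝ) (ρ : ℝ)
    (X : Fin N → Matrix (Fin n) (Fin n) ℝ) (i : Fin N) : Matrix (Fin n) (Fin n) ℝ :=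
  X i * (net.A ρ + δ i • 1 + net.B₂ i * (net.D₂ i)ᵀ * (net.E₂ i)⁻¹ * net.C₂ i)
    + (net.A ρ + δ i • 1 + net.B₂ i * (net.D₂ i)ᵀ * (net.E₂ i)⁻¹ * net.C₂ i)ᵀ * X i
    + ((net.inDeg i : ℝ) + (net.outDeg i : ℝ)) • 1
    - γ ^ 2 • ((net.C₂ i)ᵀ * (net.E₂ i)⁻¹ * net.C₂ i)
    - γ ^ 2 • ∑ j ∈ net.nbrs i, (net.H i j)ᵀ * (net.F i j)⁻¹ * net.H i j
    + Q i

/-- `Ξᵢ`, the row of the blocks `γ² H_{ij}' F_{ij}⁻¹ H_{ij} - I`, `j ∈ Vᵢ`. -/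
def lmiXi (γ : ℝ) (i : Fin N) : Matrix (Fin n) (Fin n × {j // j ∈ net.nbrs i}) ℝ :=
  Matrix.of fun a p =>
    (γ ^ 2 • ((net.H i p.2)ᵀ * (net.F i p.2)⁻¹ * net.H i p.2) - 1 :
      Matrix (Fin n) (Fin n) ℝ) a p.1

/-- `Tᵢ = [Xᵢ B₂₀, Xᵢ B₂ᵢ (I - D₂ᵢ' E₂ᵢ⁻¹ D₂ᵢ), Ξᵢ]`. -/
def lmiT (γ : ℝ) (X : Fin N → Matrix (Fin n) (Fin n) ℝ) (i : Fin N) :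
    Matrix (Fin n) (Fin net.r₀ ⊕ (Fin (net.r i) ⊕ (Fin n × {j // j ∈ net.nbrs i}))) ℝ :=
  fromCols (X i * net.B₂₀)
    (fromCols (X i * net.B₂ i * (1 - (net.D₂ i)ᵀ * (net.E₂ i)⁻¹ * net.D₂ i)) (net.lmiXi γ i))

/-- `Zᵢ`, the block diagonal matrix of the blocks `(2 δⱼ / (qⱼ + 1)) Xⱼ`, `j ∈ Vᵢ`. -/
def lmiZ (δ : Fin N → ℝ) (X : Fin N → Matrix (Fin n) (Fin n) ℝ) (i : Fin N) :
    Matrix (Fin n × {j // j ∈ net.nbrs i}) (Fin n × {j // j ∈ net.nbrs i}) ℝ :=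
  blockDiagonal fun j => (2 * δ j / ((net.outDeg j : ℝ) + 1)) • X j

/-- `Υᵢ = diag[γ² I, γ² I, Zᵢ]`. -/
def lmiUpsilon (γ : ℝ) (δ : Fin N → ℝ) (X : Fin N → Matrix (Fin n) (Fin n) ℝ) (i : Fin N) :
    Matrix (Fin net.r₀ ⊕ (Fin (net.r i) ⊕ (Fin n × {j // j ∈ net.nbrs i})))
      (Fin net.r₀ ⊕ (Fin (net.r i) ⊕ (Fin n × {j // j ∈ net.nbrs i}))) ℝ :=
  fromBlocks (γ ^ 2 • 1) 0 0 (fromBlocks (γ ^ 2 • 1) 0 0 (net.lmiZ δ X i))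

/-- The matrix on the left-hand side of the `i`-th matrix inequality,
`[Sᵢ(ρ) + θᵢ α² I, Tᵢ, Xᵢ; Tᵢ', -Υᵢ, 0; Xᵢ, 0, -θᵢ I]`. -/
def lmiMatrix (γ α : ℝ) (δ : Fin N → ℝ) (Q : Fin N → Matrix (Fin n) (Fin n) ℝ) (ρ : ℝ)
    (θ : Fin N → ℝ) (X : Fin N → Matrix (Fin n) (Fin n) ℝ) (i : Fin N) :
    Matrix
      ((Fin n ⊕ (Fin net.r₀ ⊕ (Fin (net.r i) ⊕ (Fin n × {j // j ∈ net.nbrs i})))) ⊕ Fin n)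
      ((Fin n ⊕ (Fin net.r₀ ⊕ (Fin (net.r i) ⊕ (Fin n × {j // j ∈ net.nbrs i})))) ⊕ Fin n) ℝ :=
  fromBlocks
    (fromBlocks (net.lmiS γ δ Q ρ X i + (θ i * α ^ 2) • 1) (net.lmiT γ X i)
      (net.lmiT γ X i)ᵀ (-net.lmiUpsilon γ δ X i))
    (fromRows (X i) 0)
    (fromCols (X i) 0)
    (-(θ i • 1))

/-- `(θᵢ, Xᵢ)`, `i = 1, …, N`, is a feasible collection for the coupled matrix inequalities at the
parameter value `ρ`. -/
def LMIFeasible (γ α : ℝ) (δ : Fin N → ℝ) (Q : Fin N → Matrix (Fin n) (Fin n) ℝ) (ρ : ℝ)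
    (θ : Fin N → ℝ) (X : Fin N → Matrix (Fin n) (Fin n) ℝ) : Prop :=
  ∀ i, 0 < θ i ∧ (X i).PosDef ∧ (-net.lmiMatrix γ α δ Q ρ θ X i).PosDef

/-! ### Interpolated gains -/

/-- `K_{ij}(ρ) = γ² X_{i,ρ}⁻¹ H_{ij}' F_{ij}⁻¹`. -/
def gainK (γ : ℝ) (X : Fin N → ℝ → Matrix (Fin n) (Fin n) ℝ) : net.InterconnectionGains :=
  fun i j ρ => γ ^ 2 • ((X i ρ)⁻¹ * (net.H i j)ᵀ * (net.F i j)⁻¹)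

/-- `Lᵢ(ρ) = (γ² X_{i,ρ}⁻¹ C₂ᵢ' - B₂ᵢ D₂ᵢ') E₂ᵢ⁻¹`. -/
def gainL (γ : ℝ) (X : Fin N → ℝ → Matrix (Fin n) (Fin n) ℝ) : net.ObserverGains :=
  fun i ρ => (γ ^ 2 • ((X i ρ)⁻¹ * (net.C₂ i)ᵀ) - net.B₂ i * (net.D₂ i)ᵀ) * (net.E₂ i)⁻¹

end BilinearNetwork

open Classical in
/-- Linear interpolation between adjacent grid points `g k` of the values `X k`: for
`ρ ∈ [gᵏ, gᵏ⁺¹]`,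
`X_ρ = ((gᵏ⁺¹ - ρ) / (gᵏ⁺¹ - gᵏ)) Xᵏ + ((ρ - gᵏ) / (gᵏ⁺¹ - gᵏ)) Xᵏ⁺¹`
(by `gridInterp_eq` it does not matter which `k` is selected at a grid point). The value `0` outside
the grid is irrelevant. -/
def gridInterp {n M : ℕ} (g : Fin (M + 1) → ℝ) (X : Fin (M + 1) → Matrix (Fin n) (Fin n) ℝ)
    (ρ : ℝ) : Matrix (Fin n) (Fin n) ℝ :=
  if h : ∃ k : Fin M, ρ ∈ Set.Icc (g k.castSucc) (g k.succ) then
    ((g h.choose.succ - ρ) / (g h.choose.succ - g h.choose.castSucc)) • X h.choose.castSucc +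
    ((ρ - g h.choose.castSucc) / (g h.choose.succ - g h.choose.castSucc)) • X h.choose.succ
  else 0

theorem gridInterp_eq {n M : ℕ} {g : Fin (M + 1) → ℝ} (hg : StrictMono g)
    (X : Fin (M + 1) → Matrix (Fin n) (Fin n) ℝ) {ρ : ℝ} (k : Fin M)
    (hk : ρ ∈ Set.Icc (g k.castSucc) (g k.succ)) :
    gridInterp g X ρ =
      ((g k.succ - ρ) / (g k.succ - g k.castSucc)) • X k.castSucc +
      ((ρ - g k.castSucc) / (g k.succ - g k.castSucc)) • X k.succ := by
  have key : ∀ a b : Fin M, a < b → ρ ∈ Set.Icc (g a.castSucc) (g a.succ) →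
      ρ ∈ Set.Icc (g b.castSucc) (g b.succ) →
      ((g a.succ - ρ) / (g a.succ - g a.castSucc)) • X a.castSucc +
        ((ρ - g a.castSucc) / (g a.succ - g a.castSucc)) • X a.succ =
      ((g b.succ - ρ) / (g b.succ - g b.castSucc)) • X b.castSucc +
        ((ρ - g b.castSucc) / (g b.succ - g b.castSucc)) • X b.succ := by
    intro a b hab ha hb
    have hle : a.succ ≤ b.castSucc := by
      rw [Fin.le_def]
      simpa using hab
    have h1 : g a.succ = ρ := le_antisymm ((hg.monotone hle).trans hb.1) ha.2
    have h2 : g b.castSucc = ρ := le_antisymm hb.1 (ha.2.trans (hg.monotone hle))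
    have h3 : a.succ = b.castSucc := hg.injective (h1.trans h2.symm)
    have h4 : g a.castSucc < g a.succ := hg a.castSucc_lt_succ
    have h5 : g b.castSucc < g b.succ := hg b.castSucc_lt_succ
    rw [h1] at h4
    rw [h2] at h5
    rw [h1, h2, h3, sub_self, zero_div, zero_smul, zero_div, zero_smul, zero_add, add_zero,
      div_self (sub_pos.2 h4).ne', div_self (sub_pos.2 h5).ne']
  have h : ∃ k : Fin M, ρ ∈ Set.Icc (g k.castSucc) (g k.succ) := ⟨k, hk⟩
  rw [gridInterp, dif_pos h]
  rcases lt_trichotomy h.choose k with hlt | heq | hgt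
  · exact key _ _ hlt h.choose_spec hk
  · rw [heq]
  · exact (key _ _ hgt hk h.choose_spec).symm

/-- The bound
`minᵢ { λ_min(Qᵢ) [ sup_k ‖X_{i,k+1} - X_{i,k}‖ / (gᵏ⁺¹ - gᵏ) ]⁻¹ }`
on the rate of the parameter variations, in `[0,∞]` (it is infinite if all `X_{i,k}` are independent
of `k`). -/
def rateBound {N n M : ℕ} (g : Fin (M + 1) → ℝ) (Q : Fin N → Matrix (Fin n) (Fin n) ℝ)
    (X : Fin N → Fin (M + 1) → Matrix (Fin n) (Fin n) ℝ) : ℝ≥0∞ :=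
  ⨅ i, ENNReal.ofReal (lambdaMin (Q i)) *
    (⨆ k : Fin M, ENNReal.ofReal
      (specNorm (X i k.succ - X i k.castSucc) / (g k.succ - g k.castSucc)))⁻¹

/-- `sup_{t ≥ 0} |dρ/dt|`, in `[0,∞]` (with the one-sided derivative at `t = 0`). -/
def supRate (ρ : ℝ → ℝ) : ℝ≥0∞ :=
  ⨆ t ∈ Set.Ici (0 : ℝ), ENNReal.ofReal |derivWithin ρ (Set.Ici 0) t|

end

/-! The Lyapunov function is `V = ∑ᵢ eᵢ'X_{i,ρ}eᵢ`, and everything follows from one dissipation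
inequality, valid for almost every `t > 0`: `V̇ ≤ γ²(N‖w₀‖² + ∑ᵢ(‖wᵢ‖² + ∑ⱼ‖w_{ij}‖²)) - NΨ(e) -
(1-η) e'Qe - κV` with some `κ > 0`. Integrating it, with `V(0) = γ²N e(0)'Pe(0)`, gives the `H∞`
bound. Keeping only the `κV` term gives exponential decay without disturbances, and convergence to
zero under `L₂` disturbances. Stability thus rests on `κ` and not on `Q`, so `η = 1` is admissible:
it is the weak problem.

The inequality has three sources.

From grid points to all `ρ`: testing the `i`-th matrix inequality at `ρᵏ` on a vector whose last
block is `(ρ-ρᵏ)Δe` absorbs the change of `A` while `|ρ-ρᵏ|σ(Δ) ≤ α` (`LMIFeasible.reducedForm_le`).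
The remaining form is affine in the matrices `X`, so its sign survives interpolation between the two
ends of a cell (`reducedForm_gridInterp_le`).

From the matrix inequality to the error dynamics: the gains are such that, after completing squares
in the measurement noise, the form evaluated at `z = e` bounds `2eᵢ'Xᵢėᵢ`
(`two_mul_dotProduct_errorField_le`). In the sum over the agents the coupling terms with weight
`2δⱼ/(qⱼ+1)` are counted `qⱼ` times, less than the available `2δⱼ`; the remainder is `κV`.

From the variation of `X_{i,ρ(t)}`: the rate bound makes `t ↦ e'X_{i,ρ(t)}e` Lipschitz with constant
`η e'Qᵢe`, to be subtracted from the `e'Qᵢe` in the matrix inequality. Since `X_{i,ρ}` has corners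
at the grid points and the disturbances are only `L₂`, `V` is handled as an absolutely continuous
function. -/

noncomputable section

/-! ### Quadratic forms of real matrices. -/

section QuadraticForms

variable {ι κ : Type*}

theorem Matrix.IsHermitian.transpose_eq_self {A : Matrix ι ι ℝ} (hA : A.IsHermitian) : Aᵀ = A := by
  have h := hA.eq
  rwa [conjTranspose_eq_transpose_of_trivial] at h

variable [Fintype ι] [Fintype κ]

theorem normSq_nonneg (v : ι → ℝ) : 0 ≤ normSq v :=
  Finset.sum_nonneg fun i _ => mul_self_nonneg (v i)

theorem normSq_sub (v w : ι → ℝ) : normSq (v - w) = normSq v - 2 * (v ⬝ᵥ w) + normSq w := by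
  simp only [normSq, sub_dotProduct, dotProduct_sub, dotProduct_comm w v]
  ring

theorem normSq_smul (c : ℝ) (v : ι → ℝ) : normSq (c • v) = c ^ 2 * normSq v := by
  simp only [normSq, smul_dotProduct, dotProduct_smul, smul_eq_mul]
  ring

theorem mulVec_dotProduct (A : Matrix κ ι ℝ) (v : ι → ℝ) (w : κ → ℝ) :
    A *ᵥ v ⬝ᵥ w = v ⬝ᵥ Aᵀ *ᵥ w := by
  rw [dotProduct_comm, dotProduct_mulVec, ← mulVec_transpose, dotProduct_comm]

theorem Matrix.IsHermitian.mulVec_dotProduct_comm {A : Matrix ι ι ℝ} (hA : A.IsHermitian)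
    (v w : ι → ℝ) : A *ᵥ v ⬝ᵥ w = v ⬝ᵥ A *ᵥ w := by
  rw [mulVec_dotProduct, hA.transpose_eq_self]

theorem Matrix.PosDef.quadForm_nonneg {A : Matrix ι ι ℝ} (hA : A.PosDef) (v : ι → ℝ) :
    0 ≤ v ⬝ᵥ A *ᵥ v := by
  simpa using hA.posSemidef.dotProduct_mulVec_nonneg v

variable [DecidableEq ι]

theorem dotProduct_blockDiagonal_mulVec (M : ι → Matrix κ κ ℝ) (x : κ × ι → ℝ) :
    x ⬝ᵥ blockDiagonal M *ᵥ x =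
      ∑ i, (fun a => x (a, i)) ⬝ᵥ M i *ᵥ fun a => x (a, i) := by
  rw [dotProduct, Fintype.sum_prod_type_right]
  refine Finset.sum_congr rfl fun i _ => Finset.sum_congr rfl fun a _ => ?_
  congr 1
  rw [mulVec, dotProduct, Fintype.sum_prod_type]
  refine Finset.sum_congr rfl fun b _ => ?_
  simp only [blockDiagonal_apply, ite_mul, zero_mul]
  rw [Finset.sum_ite_eq Finset.univ i]
  simp

theorem Matrix.PosDef.blockDiagonal {M : ι → Matrix κ κ ℝ} (hM : ∀ i, (M i).PosDef) :
    (Matrix.blockDiagonal M).PosDef := by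
  refine Matrix.PosDef.of_dotProduct_mulVec_pos ?_ fun {x} hx => ?_
  · rw [IsHermitian, blockDiagonal_conjTranspose]
    exact congrArg _ (funext fun i => (hM i).1)
  · rw [star_trivial, dotProduct_blockDiagonal_mulVec]
    obtain ⟨⟨a, i⟩, hai⟩ := Function.ne_iff.1 hx
    refine Finset.sum_pos' (fun i _ => (hM i).quadForm_nonneg _) ⟨i, Finset.mem_univ i, ?_⟩
    have hne : (fun a => x (a, i)) ≠ 0 := fun h => hai (congrFun h a)
    simpa using (hM i).dotProduct_mulVec_pos hne

/-- Subtracting `c` times the identity shifts the spectrum by `c`, so the difference is positive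
semidefinite. -/
theorem Matrix.IsHermitian.le_quadForm {A : Matrix ι ι ℝ} (hA : A.IsHermitian) {c : ℝ}
    (hc : ∀ μ ∈ spectrum ℝ A, c ≤ μ) (v : ι → ℝ) : c * normSq v ≤ v ⬝ᵥ A *ᵥ v := by
  have hH : (A - algebraMap ℝ (Matrix ι ι ℝ) c).IsHermitian := by
    refine hA.sub ?_
    rw [Algebra.algebraMap_eq_smul_one]
    ext i j
    simp [Matrix.one_apply, eq_comm]
  have hP : (A - algebraMap ℝ (Matrix ι ι ℝ) c).PosSemidef := by
    rw [hH.posSemidef_iff_eigenvalues_nonneg]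
    intro i
    have h := hH.eigenvalues_mem_spectrum_real i
    rw [← spectrum.sub_singleton_eq, Set.sub_singleton] at h
    obtain ⟨μ, hμ, h⟩ := h
    have := hc μ hμ
    simp only [Pi.zero_apply]
    linarith
  have h := hP.dotProduct_mulVec_nonneg v
  rw [Algebra.algebraMap_eq_smul_one] at h
  simp only [star_trivial, sub_mulVec, smul_mulVec, one_mulVec, dotProduct_sub,
    dotProduct_smul, smul_eq_mul] at h
  unfold normSq
  linarith

theorem Matrix.PosDef.exists_le_quadForm {A : Matrix ι ι ℝ} (hA : A.PosDef) :
    ∃ ε > 0, ∀ v : ι → ℝ, ε * normSq v ≤ v ⬝ᵥ A *ᵥ v := by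
  have hpos : ∀ μ ∈ spectrum ℝ A, 0 < μ := by
    intro μ hμ
    rw [hA.1.spectrum_real_eq_range_eigenvalues] at hμ
    obtain ⟨i, rfl⟩ := hμ
    exact hA.eigenvalues_pos i
  have hfin : (spectrum ℝ A).Finite := by
    rw [hA.1.spectrum_real_eq_range_eigenvalues]
    exact Set.finite_range _
  obtain ⟨ε, hε, h⟩ : ∃ ε > 0, ∀ μ ∈ spectrum ℝ A, ε ≤ μ := by
    rcases (spectrum ℝ A).eq_empty_or_nonempty with h | h
    -- The spectrum is empty only for matrices of size zero, where any `ε` works.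
    · exact ⟨1, one_pos, by simp [h]⟩
    · obtain ⟨m, hm, hmin⟩ := hfin.exists_minimalFor id _ h
      refine ⟨m, hpos m hm, fun μ hμ => ?_⟩
      rcases le_total m μ with h | h
      · exact h
      · exact hmin hμ h
  exact ⟨ε, hε, hA.1.le_quadForm h⟩

end QuadraticForms

/-! ### Smallest eigenvalue and spectral norm as bounds on quadratic forms. -/

section SpectralNorm

variable {n : ℕ}

theorem Matrix.PosDef.lambdaMin_nonneg {A : Matrix (Fin n) (Fin n) ℝ} (hA : A.PosDef) :
    0 ≤ lambdaMin A := by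
  refine Real.sInf_nonneg fun μ hμ => ?_
  rw [hA.1.spectrum_real_eq_range_eigenvalues] at hμ
  obtain ⟨i, rfl⟩ := hμ
  exact (hA.eigenvalues_pos i).le

theorem Matrix.IsHermitian.lambdaMin_mul_normSq_le {A : Matrix (Fin n) (Fin n) ℝ}
    (hA : A.IsHermitian) (v : Fin n → ℝ) : lambdaMin A * normSq v ≤ v ⬝ᵥ A *ᵥ v := by
  refine hA.le_quadForm (fun μ hμ => csInf_le ?_ hμ) v
  rw [hA.spectrum_real_eq_range_eigenvalues]
  exact (Set.finite_range _).bddBelow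

theorem specNorm_nonneg (A : Matrix (Fin n) (Fin n) ℝ) : 0 ≤ specNorm A := norm_nonneg _

theorem norm_toLp_sq (v : Fin n → ℝ) : ‖WithLp.toLp 2 v‖ ^ 2 = normSq v := by
  rw [EuclideanSpace.norm_sq_eq, normSq, dotProduct]
  simp [sq]

theorem normSq_mulVec_le (A : Matrix (Fin n) (Fin n) ℝ) (v : Fin n → ℝ) :
    normSq (A *ᵥ v) ≤ specNorm A ^ 2 * normSq v := by
  have h := (Matrix.toEuclideanCLM (𝕜 := ℝ) A).le_opNorm (WithLp.toLp 2 v)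
  rw [toEuclideanCLM_toLp] at h
  rw [← norm_toLp_sq, ← norm_toLp_sq, ← mul_pow]
  exact pow_le_pow_left₀ (norm_nonneg _) h 2

theorem abs_quadForm_le (A : Matrix (Fin n) (Fin n) ℝ) (v : Fin n → ℝ) :
    |v ⬝ᵥ A *ᵥ v| ≤ specNorm A * normSq v := by
  have h := (Matrix.toEuclideanCLM (𝕜 := ℝ) A).le_opNorm (WithLp.toLp 2 v)
  have h2 := abs_real_inner_le_norm (WithLp.toLp 2 v)
    ((Matrix.toEuclideanCLM (𝕜 := ℝ) A) (WithLp.toLp 2 v))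
  rw [inner_toEuclideanCLM] at h2
  rw [← norm_toLp_sq]
  calc |v ⬝ᵥ A *ᵥ v| ≤ _ := h2
    _ ≤ ‖WithLp.toLp 2 v‖ * (‖Matrix.toEuclideanCLM (𝕜 := ℝ) A‖ * ‖WithLp.toLp 2 v‖) := by gcongr
    _ = specNorm A * ‖WithLp.toLp 2 v‖ ^ 2 := by unfold specNorm; ring

end SpectralNorm

/-! ### The matrix inequalities as scalar inequalities. -/

namespace BilinearNetwork

variable {N n : ℕ} (net : BilinearNetwork N n)

/-- The quadratic form of the upper left `2 × 2` block of the matrix inequality, without the term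
`θᵢ α² I`, as a function of `e`, `w₀`, `w` and `z`. -/
def reducedForm (γ : ℝ) (δ : Fin N → ℝ) (Q : Fin N → Matrix (Fin n) (Fin n) ℝ) (ρ : ℝ)
    (X : Fin N → Matrix (Fin n) (Fin n) ℝ) (i : Fin N) (e : Fin n → ℝ) (w₀ : Fin net.r₀ → ℝ)
    (w : Fin (net.r i) → ℝ) (z : Fin N → Fin n → ℝ) : ℝ :=
  2 * (e ⬝ᵥ X i *ᵥ (net.A ρ *ᵥ e + δ i • e +
      net.B₂ i *ᵥ ((net.D₂ i)ᵀ *ᵥ ((net.E₂ i)⁻¹ *ᵥ (net.C₂ i *ᵥ e))) + net.B₂₀ *ᵥ w₀ +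
      net.B₂ i *ᵥ (w - (net.D₂ i)ᵀ *ᵥ ((net.E₂ i)⁻¹ *ᵥ (net.D₂ i *ᵥ w)))))
    + ((net.inDeg i : ℝ) + (net.outDeg i : ℝ)) * normSq e
    - γ ^ 2 * (net.C₂ i *ᵥ e ⬝ᵥ (net.E₂ i)⁻¹ *ᵥ (net.C₂ i *ᵥ e))
    - γ ^ 2 * ∑ j ∈ net.nbrs i, net.H i j *ᵥ e ⬝ᵥ (net.F i j)⁻¹ *ᵥ (net.H i j *ᵥ e)
    + e ⬝ᵥ Q i *ᵥ e
    + 2 * ∑ j ∈ net.nbrs i,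
        (γ ^ 2 * (net.H i j *ᵥ e ⬝ᵥ (net.F i j)⁻¹ *ᵥ (net.H i j *ᵥ z j)) - e ⬝ᵥ z j)
    - γ ^ 2 * normSq w₀ - γ ^ 2 * normSq w
    - ∑ j ∈ net.nbrs i, 2 * δ j / ((net.outDeg j : ℝ) + 1) * (z j ⬝ᵥ X j *ᵥ z j)

theorem dotProduct_lmiS_mulVec (γ : ℝ) (δ : Fin N → ℝ) (Q : Fin N → Matrix (Fin n) (Fin n) ℝ)
    (ρ : ℝ) (X : Fin N → Matrix (Fin n) (Fin n) ℝ) (i : Fin N) (hX : (X i).IsHermitian)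
    (e : Fin n → ℝ) :
    e ⬝ᵥ net.lmiS γ δ Q ρ X i *ᵥ e =
      2 * (e ⬝ᵥ X i *ᵥ (net.A ρ *ᵥ e + δ i • e +
        net.B₂ i *ᵥ ((net.D₂ i)ᵀ *ᵥ ((net.E₂ i)⁻¹ *ᵥ (net.C₂ i *ᵥ e)))))
      + ((net.inDeg i : ℝ) + (net.outDeg i : ℝ)) * normSq e
      - γ ^ 2 * (net.C₂ i *ᵥ e ⬝ᵥ (net.E₂ i)⁻¹ *ᵥ (net.C₂ i *ᵥ e))
      - γ ^ 2 * ∑ j ∈ net.nbrs i, net.H i j *ᵥ e ⬝ᵥ (net.F i j)⁻¹ *ᵥ (net.H i j *ᵥ e)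
      + e ⬝ᵥ Q i *ᵥ e := by
  set W := net.A ρ + δ i • 1 + net.B₂ i * (net.D₂ i)ᵀ * (net.E₂ i)⁻¹ * net.C₂ i with hW
  have hWe : W *ᵥ e = net.A ρ *ᵥ e + δ i • e +
        net.B₂ i *ᵥ ((net.D₂ i)ᵀ *ᵥ ((net.E₂ i)⁻¹ *ᵥ (net.C₂ i *ᵥ e))) := by
    simp only [hW, add_mulVec, smul_mulVec, one_mulVec, ← mulVec_mulVec]
  have hsymm : e ⬝ᵥ (Wᵀ * X i) *ᵥ e = e ⬝ᵥ X i *ᵥ (W *ᵥ e) := by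
    rw [← mulVec_mulVec, ← mulVec_dotProduct, ← hX.mulVec_dotProduct_comm, dotProduct_comm]
  rw [lmiS, ← hW, ← hWe]
  simp only [add_mulVec, sub_mulVec, dotProduct_add, dotProduct_sub, smul_mulVec, one_mulVec,
    dotProduct_smul, smul_eq_mul, hsymm, sum_mulVec, dotProduct_sum]
  simp only [← mulVec_mulVec, ← mulVec_dotProduct, normSq]
  ring

theorem lmiXi_mulVec (γ : ℝ) (i : Fin N) (z : Fin N → Fin n → ℝ) :
    net.lmiXi γ i *ᵥ (fun p => z p.2 p.1) =
      ∑ j ∈ net.nbrs i, (γ ^ 2 • ((net.H i j)ᵀ * (net.F i j)⁻¹ * net.H i j) - 1) *ᵥ z j := by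
  rw [← Finset.sum_coe_sort (net.nbrs i)
    fun j => (γ ^ 2 • ((net.H i j)ᵀ * (net.F i j)⁻¹ * net.H i j) - 1) *ᵥ z j]
  ext a
  rw [Finset.sum_apply, mulVec, dotProduct, Fintype.sum_prod_type_right]
  rfl

theorem dotProduct_lmiXi_mulVec (γ : ℝ) (i : Fin N) (e : Fin n → ℝ) (z : Fin N → Fin n → ℝ) :
    e ⬝ᵥ net.lmiXi γ i *ᵥ (fun p => z p.2 p.1) =
      ∑ j ∈ net.nbrs i,
        (γ ^ 2 * (net.H i j *ᵥ e ⬝ᵥ (net.F i j)⁻¹ *ᵥ (net.H i j *ᵥ z j)) - e ⬝ᵥ z j) := by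
  rw [lmiXi_mulVec, dotProduct_sum]
  refine Finset.sum_congr rfl fun j _ => ?_
  simp only [sub_mulVec, smul_mulVec, one_mulVec, dotProduct_sub, dotProduct_smul, smul_eq_mul,
    ← mulVec_mulVec, ← mulVec_dotProduct]

theorem dotProduct_lmiZ_mulVec (δ : Fin N → ℝ) (X : Fin N → Matrix (Fin n) (Fin n) ℝ) (i : Fin N)
    (z : Fin N → Fin n → ℝ) :
    (fun p : Fin n × {j // j ∈ net.nbrs i} => z p.2 p.1) ⬝ᵥ
        net.lmiZ δ X i *ᵥ (fun p => z p.2 p.1) =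
      ∑ j ∈ net.nbrs i, 2 * δ j / ((net.outDeg j : ℝ) + 1) * (z j ⬝ᵥ X j *ᵥ z j) := by
  rw [← Finset.sum_coe_sort (net.nbrs i)
    fun j => 2 * δ j / ((net.outDeg j : ℝ) + 1) * (z j ⬝ᵥ X j *ᵥ z j)]
  rw [lmiZ, dotProduct_blockDiagonal_mulVec]
  refine Finset.sum_congr rfl fun j _ => ?_
  rw [smul_mulVec, dotProduct_smul, smul_eq_mul]

theorem dotProduct_lmiT_mulVec (γ : ℝ) (X : Fin N → Matrix (Fin n) (Fin n) ℝ) (i : Fin N)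
    (e : Fin n → ℝ) (w₀ : Fin net.r₀ → ℝ) (w : Fin (net.r i) → ℝ) (z : Fin N → Fin n → ℝ) :
    e ⬝ᵥ net.lmiT γ X i *ᵥ Sum.elim w₀ (Sum.elim w fun p => z p.2 p.1) =
      e ⬝ᵥ X i *ᵥ (net.B₂₀ *ᵥ w₀ +
        net.B₂ i *ᵥ (w - (net.D₂ i)ᵀ *ᵥ ((net.E₂ i)⁻¹ *ᵥ (net.D₂ i *ᵥ w)))) +
      ∑ j ∈ net.nbrs i,
        (γ ^ 2 * (net.H i j *ᵥ e ⬝ᵥ (net.F i j)⁻¹ *ᵥ (net.H i j *ᵥ z j)) - e ⬝ᵥ z j) := by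
  rw [lmiT, fromCols_mulVec_sumElim, fromCols_mulVec_sumElim, dotProduct_add, dotProduct_add,
    dotProduct_lmiXi_mulVec]
  simp only [← mulVec_mulVec, sub_mulVec, one_mulVec, mulVec_add, mulVec_sub, dotProduct_add,
    dotProduct_sub]
  ring

theorem dotProduct_lmiUpsilon_mulVec (γ : ℝ) (δ : Fin N → ℝ)
    (X : Fin N → Matrix (Fin n) (Fin n) ℝ) (i : Fin N) (w₀ : Fin net.r₀ → ℝ)
    (w : Fin (net.r i) → ℝ) (z : Fin N → Fin n → ℝ) :
    Sum.elim w₀ (Sum.elim w fun p => z p.2 p.1) ⬝ᵥ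
        net.lmiUpsilon γ δ X i *ᵥ Sum.elim w₀ (Sum.elim w fun p => z p.2 p.1) =
      γ ^ 2 * normSq w₀ + γ ^ 2 * normSq w +
        ∑ j ∈ net.nbrs i, 2 * δ j / ((net.outDeg j : ℝ) + 1) * (z j ⬝ᵥ X j *ᵥ z j) := by
  rw [lmiUpsilon, fromBlocks_mulVec, sumElim_dotProduct_sumElim]
  simp only [Sum.elim_comp_inl, Sum.elim_comp_inr, zero_mulVec, add_zero, zero_add]
  rw [fromBlocks_mulVec, sumElim_dotProduct_sumElim]
  simp only [Sum.elim_comp_inl, Sum.elim_comp_inr, zero_mulVec, add_zero, zero_add,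
    dotProduct_lmiZ_mulVec, smul_mulVec, one_mulVec, dotProduct_smul, smul_eq_mul, normSq]
  ring

/-- Turns definiteness of the block matrix into a scalar inequality. The argument `z` runs over all
agents, although only neighbours enter, so that the whole error vector can be substituted for it. -/
theorem dotProduct_lmiMatrix_mulVec (γ α : ℝ) (δ : Fin N → ℝ)
    (Q : Fin N → Matrix (Fin n) (Fin n) ℝ) (ρ : ℝ) (θ : Fin N → ℝ)
    (X : Fin N → Matrix (Fin n) (Fin n) ℝ) (i : Fin N) (hX : (X i).IsHermitian)
    (e y : Fin n → ℝ) (w₀ : Fin net.r₀ → ℝ) (w : Fin (net.r i) → ℝ) (z : Fin N → Fin n → ℝ) :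
    Sum.elim (Sum.elim e (Sum.elim w₀ (Sum.elim w fun p => z p.2 p.1))) y ⬝ᵥ
      net.lmiMatrix γ α δ Q ρ θ X i *ᵥ
        Sum.elim (Sum.elim e (Sum.elim w₀ (Sum.elim w fun p => z p.2 p.1))) y =
      net.reducedForm γ δ Q ρ X i e w₀ w z + θ i * α ^ 2 * normSq e + 2 * (e ⬝ᵥ X i *ᵥ y)
        - θ i * normSq y := by
  rw [lmiMatrix, fromBlocks_mulVec, sumElim_dotProduct_sumElim]
  simp only [Sum.elim_comp_inl, Sum.elim_comp_inr]
  rw [fromBlocks_mulVec]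
  simp only [Sum.elim_comp_inl, Sum.elim_comp_inr]
  rw [fromRows_mulVec, fromCols_mulVec_sumElim, dotProduct_add, sumElim_dotProduct_sumElim,
    sumElim_dotProduct_sumElim]
  have h1 : (net.lmiT γ X i)ᵀ *ᵥ e ⬝ᵥ Sum.elim w₀ (Sum.elim w fun p => z p.2 p.1) =
      e ⬝ᵥ net.lmiT γ X i *ᵥ Sum.elim w₀ (Sum.elim w fun p => z p.2 p.1) := by
    rw [mulVec_dotProduct, transpose_transpose]
  simp only [zero_mulVec, dotProduct_zero, add_zero, add_mulVec, neg_mulVec, dotProduct_add,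
    dotProduct_neg, smul_mulVec, one_mulVec, dotProduct_smul, smul_eq_mul]
  rw [dotProduct_comm _ ((net.lmiT γ X i)ᵀ *ᵥ e), h1, dotProduct_comm y, hX.mulVec_dotProduct_comm,
    dotProduct_lmiS_mulVec _ _ _ _ _ _ _ hX, dotProduct_lmiT_mulVec, dotProduct_lmiUpsilon_mulVec]
  simp only [reducedForm, mulVec_add, dotProduct_add, normSq]
  ring

/-- The parameter enters only through `A(ρ)`, which is affine with slope `Δ`. -/
theorem reducedForm_sub_reducedForm (γ : ℝ) (δ : Fin N → ℝ)
    (Q : Fin N → Matrix (Fin n) (Fin n) ℝ) (ρ ρ₀ : ℝ) (X : Fin N → Matrix (Fin n) (Fin n) ℝ)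
    (i : Fin N) (e : Fin n → ℝ) (w₀ : Fin net.r₀ → ℝ) (w : Fin (net.r i) → ℝ)
    (z : Fin N → Fin n → ℝ) :
    net.reducedForm γ δ Q ρ X i e w₀ w z = net.reducedForm γ δ Q ρ₀ X i e w₀ w z +
      2 * (e ⬝ᵥ X i *ᵥ ((ρ - ρ₀) • net.Δ *ᵥ e)) := by
  simp only [reducedForm, A, add_mulVec, smul_mulVec, mulVec_add, dotProduct_add, mulVec_smul,
    dotProduct_smul, smul_eq_mul]
  ring

/-- For fixed `ρ` the form is affine in the family `X`, including the blocks `Xⱼ` of the neighbours.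
-/
theorem reducedForm_convexComb (γ : ℝ) (δ : Fin N → ℝ) (Q : Fin N → Matrix (Fin n) (Fin n) ℝ)
    (ρ : ℝ) (X Y : Fin N → Matrix (Fin n) (Fin n) ℝ) {a b : ℝ} (hab : a + b = 1) (i : Fin N)
    (e : Fin n → ℝ) (w₀ : Fin net.r₀ → ℝ) (w : Fin (net.r i) → ℝ) (z : Fin N → Fin n → ℝ) :
    net.reducedForm γ δ Q ρ (fun j => a • X j + b • Y j) i e w₀ w z =
      a * net.reducedForm γ δ Q ρ X i e w₀ w z + b * net.reducedForm γ δ Q ρ Y i e w₀ w z := by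
  have h : ∀ f g : Fin N → ℝ, ∑ j ∈ net.nbrs i, 2 * δ j / ((net.outDeg j : ℝ) + 1) *
      (a * f j + b * g j) =
      a * ∑ j ∈ net.nbrs i, 2 * δ j / ((net.outDeg j : ℝ) + 1) * f j +
      b * ∑ j ∈ net.nbrs i, 2 * δ j / ((net.outDeg j : ℝ) + 1) * g j := by
    intro f g
    rw [Finset.mul_sum, Finset.mul_sum, ← Finset.sum_add_distrib]
    exact Finset.sum_congr rfl fun j _ => by ring
  simp only [reducedForm, add_mulVec, smul_mulVec, dotProduct_add, dotProduct_smul, smul_eq_mul, h]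
  -- The terms free of `X` are reproduced because the weights sum to one.
  obtain rfl : b = 1 - a := by linarith
  ring

/-- This replaces a Schur complement argument: a single test vector suffices, because the block with
`θᵢ` contributes `θᵢ(α²‖e‖² - ‖y‖²) ≥ 0`. -/
theorem LMIFeasible.reducedForm_le {γ α : ℝ} {δ : Fin N → ℝ}
    {Q : Fin N → Matrix (Fin n) (Fin n) ℝ} {ρ₀ : ℝ} {θ : Fin N → ℝ}
    {X : Fin N → Matrix (Fin n) (Fin n) ℝ} (h : net.LMIFeasible γ α δ Q ρ₀ θ X) (i : Fin N) :
    ∀ ρ, |ρ - ρ₀| * specNorm net.Δ ≤ α → ∀ e w₀ w z,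
      net.reducedForm γ δ Q ρ X i e w₀ w z ≤ 0 := by
  obtain ⟨hθ, hX, hpos⟩ := h i
  intro ρ hρ e w₀ w z
  -- With this choice the cross term `2e'Xᵢy` is exactly the change of the form from `ρ₀` to `ρ`.
  set y := (ρ - ρ₀) • net.Δ *ᵥ e with hy
  have h1 := hpos.quadForm_nonneg
    (Sum.elim (Sum.elim e (Sum.elim w₀ (Sum.elim w fun p => z p.2 p.1))) y)
  rw [neg_mulVec, dotProduct_neg, dotProduct_lmiMatrix_mulVec _ _ _ _ _ _ _ _ _ hX.1] at h1
  rw [reducedForm_sub_reducedForm _ _ _ _ ρ ρ₀, ← hy]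
  have h2 : normSq y ≤ α ^ 2 * normSq e := by
    rw [hy, normSq_smul]
    calc (ρ - ρ₀) ^ 2 * normSq (net.Δ *ᵥ e)
        ≤ (ρ - ρ₀) ^ 2 * (specNorm net.Δ ^ 2 * normSq e) := by
          gcongr; exact normSq_mulVec_le _ _
      _ = (|ρ - ρ₀| * specNorm net.Δ) ^ 2 * normSq e := by rw [mul_pow, sq_abs]; ring
      _ ≤ α ^ 2 * normSq e := by
          have := normSq_nonneg e
          have := specNorm_nonneg net.Δ
          gcongr
  have := mul_le_mul_of_nonneg_left h2 hθ.le
  linarith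

/-- The right-hand side of the error dynamics. -/
def errorField (L : net.ObserverGains) (K : net.InterconnectionGains) (ρ : ℝ)
    (e : Fin N → Fin n → ℝ) (w₀ : Fin net.r₀ → ℝ) (w : ∀ i, Fin (net.r i) → ℝ)
    (wbar : ∀ i j, Fin (net.s i j) → ℝ) (i : Fin N) : Fin n → ℝ :=
  net.A ρ *ᵥ e i + net.B₂₀ *ᵥ w₀ - L i ρ *ᵥ (net.C₂ i *ᵥ e i + net.D₂ i *ᵥ w i)
    - ∑ j ∈ net.nbrs i,
        K i j ρ *ᵥ (net.H i j *ᵥ e i - net.H i j *ᵥ e j + net.G i j *ᵥ wbar i j)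
    - net.B₂ i *ᵥ w i

/-! ### Dissipation inequality for the error vector field. -/

section Projection

variable {a b : ℕ} {D : Matrix (Fin a) (Fin b) ℝ}

theorem mulVec_sub_projection (hD : (D * Dᵀ).PosDef) (w : Fin b → ℝ) :
    D *ᵥ (w - Dᵀ *ᵥ ((D * Dᵀ)⁻¹ *ᵥ (D *ᵥ w))) = 0 := by
  rw [mulVec_sub, mulVec_mulVec, mulVec_mulVec,
    mul_nonsing_inv _ ((isUnit_iff_isUnit_det _).1 hD.isUnit),
    one_mulVec, sub_self]

/-- Pythagoras: `D'(DD')⁻¹D` is the orthogonal projection onto the row space of `D`. -/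
theorem normSq_sub_projection (hD : (D * Dᵀ).PosDef) (w : Fin b → ℝ) :
    normSq (w - Dᵀ *ᵥ ((D * Dᵀ)⁻¹ *ᵥ (D *ᵥ w))) =
      normSq w - D *ᵥ w ⬝ᵥ (D * Dᵀ)⁻¹ *ᵥ (D *ᵥ w) := by
  set s := w - Dᵀ *ᵥ ((D * Dᵀ)⁻¹ *ᵥ (D *ᵥ w)) with hs
  have h1 : (Dᵀ *ᵥ ((D * Dᵀ)⁻¹ *ᵥ (D *ᵥ w))) ⬝ᵥ s = 0 := by
    rw [mulVec_dotProduct, transpose_transpose, hs, mulVec_sub_projection hD, dotProduct_zero]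
  have h2 : normSq s = w ⬝ᵥ s := by
    rw [normSq]
    nth_rewrite 1 [hs]
    rw [sub_dotProduct, h1, sub_zero]
  rw [h2, hs, dotProduct_sub, ← mulVec_dotProduct, normSq]

theorem quadForm_inv_le_normSq (hD : (D * Dᵀ).PosDef) (w : Fin b → ℝ) :
    D *ᵥ w ⬝ᵥ (D * Dᵀ)⁻¹ *ᵥ (D *ᵥ w) ≤ normSq w := by
  have := normSq_nonneg (w - Dᵀ *ᵥ ((D * Dᵀ)⁻¹ *ᵥ (D *ᵥ w)))
  rw [normSq_sub_projection hD] at this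
  linarith

theorem quadForm_add {ι : Type*} [Fintype ι] {A : Matrix ι ι ℝ} (hA : A.IsHermitian)
    (v w : ι → ℝ) : (v + w) ⬝ᵥ A *ᵥ (v + w) = v ⬝ᵥ A *ᵥ v + 2 * (v ⬝ᵥ A *ᵥ w) + w ⬝ᵥ A *ᵥ w := by
  rw [mulVec_add, add_dotProduct, dotProduct_add, dotProduct_add, dotProduct_comm w (A *ᵥ v),
    hA.mulVec_dotProduct_comm]
  ring

end Projection

/-- The factor `X⁻¹` of the gain cancels the weight `X`, which leaves a term independent of `X` and
one that decorrelates the noise in `yᵢ` from the one in the dynamics. -/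
theorem dotProduct_mulVec_gainL {γ ρ : ℝ} {X : Fin N → ℝ → Matrix (Fin n) (Fin n) ℝ} {i : Fin N}
    (hX : (X i ρ).PosDef) (e : Fin n → ℝ) (v : Fin (net.m i) → ℝ) :
    e ⬝ᵥ X i ρ *ᵥ (net.gainL γ X i ρ *ᵥ v) =
      γ ^ 2 * (net.C₂ i *ᵥ e ⬝ᵥ (net.E₂ i)⁻¹ *ᵥ v) -
        e ⬝ᵥ X i ρ *ᵥ (net.B₂ i *ᵥ ((net.D₂ i)ᵀ *ᵥ ((net.E₂ i)⁻¹ *ᵥ v))) := by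
  have hdet := (isUnit_iff_isUnit_det _).1 hX.isUnit
  have h : net.gainL γ X i ρ *ᵥ v =
      γ ^ 2 • ((X i ρ)⁻¹ *ᵥ ((net.C₂ i)ᵀ *ᵥ ((net.E₂ i)⁻¹ *ᵥ v))) -
        net.B₂ i *ᵥ ((net.D₂ i)ᵀ *ᵥ ((net.E₂ i)⁻¹ *ᵥ v)) := by
    simp only [gainL, Matrix.sub_mul, sub_mulVec, Matrix.smul_mul, smul_mulVec, ← mulVec_mulVec]
  rw [h, mulVec_sub, mulVec_smul, mulVec_mulVec _ (X i ρ) (X i ρ)⁻¹, mul_nonsing_inv _ hdet,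
    one_mulVec, dotProduct_sub, dotProduct_smul, ← mulVec_dotProduct, smul_eq_mul]

theorem dotProduct_mulVec_gainK {γ ρ : ℝ} {X : Fin N → ℝ → Matrix (Fin n) (Fin n) ℝ}
    {i j : Fin N} (hX : (X i ρ).PosDef) (e : Fin n → ℝ) (v : Fin (net.l i j) → ℝ) :
    e ⬝ᵥ X i ρ *ᵥ (net.gainK γ X i j ρ *ᵥ v) =
      γ ^ 2 * (net.H i j *ᵥ e ⬝ᵥ (net.F i j)⁻¹ *ᵥ v) := by
  have hdet := (isUnit_iff_isUnit_det _).1 hX.isUnit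
  have h : net.gainK γ X i j ρ *ᵥ v =
      γ ^ 2 • ((X i ρ)⁻¹ *ᵥ ((net.H i j)ᵀ *ᵥ ((net.F i j)⁻¹ *ᵥ v))) := by
    simp only [gainK, smul_mulVec, ← mulVec_mulVec]
  rw [h, mulVec_smul, mulVec_mulVec _ (X i ρ) (X i ρ)⁻¹, mul_nonsing_inv _ hdet,
    one_mulVec, dotProduct_smul, ← mulVec_dotProduct, smul_eq_mul]

/-- The term `-B₂ᵢDᵢ'Eᵢ⁻¹` of `Lᵢ` reduces the action of `wᵢ` through `B₂ᵢ` to its component `s` in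
the kernel of `D₂ᵢ`. The other component acts only through `D₂ᵢwᵢ`, and completing the square with
`C₂ᵢeᵢ` bounds its effect; by Pythagoras the two costs add up to `γ²‖wᵢ‖²`. The noises `w_{ij}` are
treated by the same completion of squares. -/
theorem two_mul_dotProduct_errorField_le (hE : ∀ i, (net.E₂ i).PosDef)
    (hF : ∀ i, ∀ j ∈ net.nbrs i, (net.F i j).PosDef) {γ ρ : ℝ} {δ : Fin N → ℝ}
    {Q : Fin N → Matrix (Fin n) (Fin n) ℝ} {X : Fin N → ℝ → Matrix (Fin n) (Fin n) ℝ} {i : Fin N}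
    (hX : (X i ρ).PosDef)
    (hred : ∀ e w₀ w z, net.reducedForm γ δ Q ρ (fun j => X j ρ) i e w₀ w z ≤ 0)
    (e : Fin N → Fin n → ℝ) (w₀ : Fin net.r₀ → ℝ) (w : ∀ i, Fin (net.r i) → ℝ)
    (wbar : ∀ i j, Fin (net.s i j) → ℝ) :
    2 * (e i ⬝ᵥ X i ρ *ᵥ net.errorField (net.gainL γ X) (net.gainK γ X) ρ e w₀ w wbar i) ≤
      ∑ j ∈ net.nbrs i, 2 * (e i ⬝ᵥ e j)
      + ∑ j ∈ net.nbrs i, 2 * δ j / ((net.outDeg j : ℝ) + 1) * (e j ⬝ᵥ X j ρ *ᵥ e j)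
      - 2 * δ i * (e i ⬝ᵥ X i ρ *ᵥ e i)
      - ((net.inDeg i : ℝ) + (net.outDeg i : ℝ)) * normSq (e i) - e i ⬝ᵥ Q i *ᵥ e i
      + γ ^ 2 * (normSq w₀ + (normSq (w i) + ∑ j, normSq (wbar i j))) := by
  have hEi := hE i
  rw [E₂] at hEi
  set s := w i - (net.D₂ i)ᵀ *ᵥ ((net.E₂ i)⁻¹ *ᵥ (net.D₂ i *ᵥ w i)) with hs
  have hDs : net.D₂ i *ᵥ s = 0 := mulVec_sub_projection hEi (w i)
  have hnorm : normSq s = normSq (w i) -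
    net.D₂ i *ᵥ w i ⬝ᵥ (net.E₂ i)⁻¹ *ᵥ (net.D₂ i *ᵥ w i) := normSq_sub_projection hEi (w i)
  -- The sign is that of `-B₂ᵢwᵢ` in the error dynamics; `z = e` inserts the errors of the
  -- neighbours.
  have h1 := hred (e i) w₀ (-s) e
  have hsq := (hE i).inv.quadForm_nonneg (net.C₂ i *ᵥ e i + net.D₂ i *ᵥ w i)
  rw [quadForm_add (hE i).inv.1] at hsq
  have hj : ∀ j ∈ net.nbrs i,
      -(2 * γ ^ 2 * (net.H i j *ᵥ e i ⬝ᵥ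
        (net.F i j)⁻¹ *ᵥ (net.H i j *ᵥ e i - net.H i j *ᵥ e j + net.G i j *ᵥ wbar i j))) ≤
      -(γ ^ 2 * (net.H i j *ᵥ e i ⬝ᵥ (net.F i j)⁻¹ *ᵥ (net.H i j *ᵥ e i)))
      + 2 * (γ ^ 2 * (net.H i j *ᵥ e i ⬝ᵥ (net.F i j)⁻¹ *ᵥ (net.H i j *ᵥ e j)))
      + γ ^ 2 * normSq (wbar i j) := by
    intro j hj
    have h2 := (hF i j hj).inv.quadForm_nonneg (net.H i j *ᵥ e i + net.G i j *ᵥ wbar i j)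
    rw [quadForm_add (hF i j hj).inv.1] at h2
    have h3 : net.G i j *ᵥ wbar i j ⬝ᵥ (net.F i j)⁻¹ *ᵥ (net.G i j *ᵥ wbar i j) ≤
      normSq (wbar i j) := quadForm_inv_le_normSq (hF i j hj) (wbar i j)
    simp only [mulVec_add, mulVec_sub, dotProduct_add, dotProduct_sub]
    nlinarith [mul_nonneg (sq_nonneg γ) h2, mul_le_mul_of_nonneg_left h3 (sq_nonneg γ)]
  have hsum := Finset.sum_le_sum hj
  have hle : ∑ j ∈ net.nbrs i, normSq (wbar i j) ≤ ∑ j, normSq (wbar i j) :=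
    Finset.sum_le_univ_sum_of_nonneg fun j => normSq_nonneg _
  have hle' := mul_le_mul_of_nonneg_left hle (sq_nonneg γ)
  have hsq' := mul_nonneg (sq_nonneg γ) hsq
  have hBs : net.B₂ i *ᵥ s = net.B₂ i *ᵥ w i -
      net.B₂ i *ᵥ ((net.D₂ i)ᵀ *ᵥ ((net.E₂ i)⁻¹ *ᵥ (net.D₂ i *ᵥ w i))) := by
    rw [hs, mulVec_sub]
  have hneg : normSq (-s) = normSq s := by simp [normSq]
  simp only [reducedForm, mulVec_neg, hDs, neg_zero, mulVec_zero, sub_zero, hBs, hneg, hnorm] at h1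
  simp only [errorField, mulVec_sub _ (_ - _), mulVec_sub (X i ρ) (_ + _), mulVec_sum,
    dotProduct_sub, dotProduct_sum, dotProduct_mulVec_gainL _ hX, dotProduct_mulVec_gainK _ hX]
  simp only [mulVec_add, mulVec_sub, mulVec_neg, mulVec_smul, dotProduct_add, dotProduct_sub,
    dotProduct_neg, dotProduct_smul, smul_eq_mul, Finset.sum_add_distrib, Finset.sum_neg_distrib,
    Finset.sum_sub_distrib, ← Finset.mul_sum] at h1 hsum hsq' ⊢
  linarith

/-- Double counting of edges: the index `j` occurs once for each edge that leaves it. -/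
theorem sum_sum_nbrs (f : Fin N → ℝ) :
    ∑ i, ∑ j ∈ net.nbrs i, f j = ∑ j, (net.outDeg j : ℝ) * f j := by
  classical
  simp only [nbrs, Finset.sum_filter]
  rw [Finset.sum_comm]
  refine Finset.sum_congr rfl fun j _ => ?_
  rw [← Finset.sum_filter, Finset.sum_const, nsmul_eq_mul]
  simp only [outDeg]

theorem natCast_mul_disagreement (hN : (N : ℝ) ≠ 0) (e : Fin N → Fin n → ℝ) :
    (N : ℝ) * net.disagreement e =
      ∑ i, ((net.inDeg i : ℝ) + (net.outDeg i : ℝ)) * normSq (e i) -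
        ∑ i, ∑ j ∈ net.nbrs i, 2 * (e i ⬝ᵥ e j) := by
  have h : ∀ i, ∑ j ∈ net.nbrs i, normSq (e j - e i) =
      ∑ j ∈ net.nbrs i, normSq (e j) - ∑ j ∈ net.nbrs i, 2 * (e i ⬝ᵥ e j) +
        (net.inDeg i : ℝ) * normSq (e i) := by
    intro i
    rw [inDeg, ← nsmul_eq_mul, ← Finset.sum_const, ← Finset.sum_sub_distrib,
      ← Finset.sum_add_distrib]
    exact Finset.sum_congr rfl fun j _ => by rw [normSq_sub, dotProduct_comm]
  rw [disagreement, ← mul_assoc, mul_one_div_cancel hN, one_mul,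
    Finset.sum_congr rfl fun i _ => h i]
  simp only [Finset.sum_add_distrib, Finset.sum_sub_distrib, sum_sum_nbrs, add_mul]
  ring

theorem disagreement_nonneg (e : Fin N → Fin n → ℝ) : 0 ≤ net.disagreement e :=
  mul_nonneg (by positivity) (Finset.sum_nonneg fun _ _ => Finset.sum_nonneg fun _ _ =>
    normSq_nonneg _)

/-- Summation over agents turns the degree terms and the products `eᵢ'eⱼ` into the disagreement
function, and sets the coupling terms against the `2δᵢ` terms. -/
theorem sum_two_mul_dotProduct_errorField_le (hN : (N : ℝ) ≠ 0) (hE : ∀ i, (net.E₂ i).PosDef)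
    (hF : ∀ i, ∀ j ∈ net.nbrs i, (net.F i j).PosDef) {γ ρ κ : ℝ} {δ : Fin N → ℝ}
    (hκ : ∀ i, κ ≤ 2 * δ i / ((net.outDeg i : ℝ) + 1))
    {Q : Fin N → Matrix (Fin n) (Fin n) ℝ} {X : Fin N → ℝ → Matrix (Fin n) (Fin n) ℝ}
    (hX : ∀ i, (X i ρ).PosDef)
    (hred : ∀ i e w₀ w z, net.reducedForm γ δ Q ρ (fun j => X j ρ) i e w₀ w z ≤ 0)
    (e : Fin N → Fin n → ℝ) (w₀ : Fin net.r₀ → ℝ) (w : ∀ i, Fin (net.r i) → ℝ)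
    (wbar : ∀ i j, Fin (net.s i j) → ℝ) :
    ∑ i, 2 * (e i ⬝ᵥ X i ρ *ᵥ net.errorField (net.gainL γ X) (net.gainK γ X) ρ e w₀ w wbar i) ≤
      -((N : ℝ) * net.disagreement e) - ∑ i, e i ⬝ᵥ Q i *ᵥ e i
      - κ * ∑ i, e i ⬝ᵥ X i ρ *ᵥ e i
      + γ ^ 2 * ((N : ℝ) * normSq w₀ + ∑ i, (normSq (w i) + ∑ j, normSq (wbar i j))) := by
  have h1 := Finset.sum_le_sum fun i (_ : i ∈ Finset.univ) =>
    net.two_mul_dotProduct_errorField_le hE hF (hX i) (hred i) e w₀ w wbar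
  refine h1.trans ?_
  have h2 : ∑ j, (net.outDeg j : ℝ) *
        (2 * δ j / ((net.outDeg j : ℝ) + 1) * (e j ⬝ᵥ X j ρ *ᵥ e j)) ≤
      ∑ j, 2 * δ j * (e j ⬝ᵥ X j ρ *ᵥ e j) - κ * ∑ j, e j ⬝ᵥ X j ρ *ᵥ e j := by
    rw [Finset.mul_sum, ← Finset.sum_sub_distrib]
    refine Finset.sum_le_sum fun j _ => ?_
    have h3 := mul_le_mul_of_nonneg_right (hκ j) ((hX j).quadForm_nonneg (e j))
    -- The `+1` in the denominator leaves `2δⱼ/(qⱼ+1)` of decay, even when no edge leaves `j`.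
    have h4 : (net.outDeg j : ℝ) * (2 * δ j / ((net.outDeg j : ℝ) + 1)) =
        2 * δ j - 2 * δ j / ((net.outDeg j : ℝ) + 1) := by
      field_simp
      ring
    rw [← mul_assoc, h4, sub_mul]
    linarith
  rw [natCast_mul_disagreement net hN]
  simp only [Finset.sum_add_distrib, Finset.sum_sub_distrib, sum_sum_nbrs, ← Finset.mul_sum,
    Finset.sum_const, Finset.card_univ, Fintype.card_fin, nsmul_eq_mul] at h2 ⊢
  linarith

end BilinearNetwork

/-! ### Interpolation on the grid: bounds, Lipschitz estimates, continuity. -/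

section Grid

variable {n M : ℕ} {g : Fin (M + 1) → ℝ}

theorem exists_mem_Icc_grid (hM : 1 ≤ M) {ρ : ℝ} (hρ : ρ ∈ Set.Icc (g 0) (g (Fin.last M))) :
    ∃ k : Fin M, ρ ∈ Set.Icc (g k.castSucc) (g k.succ) := by
  by_contra! h
  -- If `ρ` lies in no cell, it passes beyond each grid point in turn. Index `0` is excluded since
  -- only `g 0 ≤ ρ` is known there.
  have hlt : ∀ k : Fin (M + 1), k ≠ 0 → g k < ρ := by
    intro k
    induction k using Fin.induction with
    | zero => intro h0; exact absurd rfl h0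
    | succ k ih =>
      intro _
      by_contra! hle
      refine h k ⟨?_, hle⟩
      by_cases hk : k.castSucc = 0
      · rw [hk]; exact hρ.1
      · exact (ih hk).le
  have hlast : Fin.last M ≠ 0 := by
    rw [Ne, Fin.ext_iff]
    simp
    omega
  exact absurd hρ.2 (not_le.2 (hlt _ hlast))

/-- Lipschitz bounds with a common constant on adjacent cells are glued by the triangle inequality
at the common grid point, with induction on the cell of the right endpoint. -/
theorem abs_sub_le_of_grid (hg : StrictMono g) {f : ℝ → ℝ} {c : ℝ}
    (hf : ∀ k : Fin M, ∀ s ∈ Set.Icc (g k.castSucc) (g k.succ),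
      ∀ t ∈ Set.Icc (g k.castSucc) (g k.succ), |f s - f t| ≤ c * |s - t|)
    {s t : ℝ} (hs : s ∈ Set.Icc (g 0) (g (Fin.last M)))
    (ht : t ∈ Set.Icc (g 0) (g (Fin.last M))) : |f s - f t| ≤ c * |s - t| := by
  have key : ∀ k : Fin (M + 1), ∀ s t, g 0 ≤ s → s ≤ t → t ≤ g k →
      |f s - f t| ≤ c * |s - t| := by
    intro k
    induction k using Fin.induction with
    | zero =>
      intro s t h1 h2 h3
      obtain rfl : s = t := by linarith
      simp
    | succ k ih =>
      intro s t h1 h2 h3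
      rcases le_total t (g k.castSucc) with h | h
      · exact ih s t h1 h2 h
      rcases le_total (g k.castSucc) s with h' | h'
      · exact hf k s ⟨h', h2.trans h3⟩ t ⟨h, h3⟩
      · have e1 := ih s (g k.castSucc) h1 h' le_rfl
        have e2 := hf k (g k.castSucc) ⟨le_rfl, (hg k.castSucc_lt_succ).le⟩ t ⟨h, h3⟩
        calc |f s - f t| ≤ |f s - f (g k.castSucc)| + |f (g k.castSucc) - f t| :=
              abs_sub_le _ _ _
          _ ≤ c * |s - g k.castSucc| + c * |g k.castSucc - t| := add_le_add e1 e2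
          _ = c * |s - t| := by
            rw [abs_of_nonpos (by linarith), abs_of_nonpos (by linarith),
              abs_of_nonpos (by linarith)]
            ring
  rcases le_total s t with h | h
  · exact key _ s t hs.1 h ht.2
  · rw [abs_sub_comm, abs_sub_comm s]
    exact key _ t s ht.1 h hs.2

/-- On each cell `φ` of the interpolant is affine in the parameter. The functional is arbitrary so
that the lemma serves both matrix entries and quadratic forms. -/
theorem abs_map_gridInterp_sub_le (hg : StrictMono g) {X : Fin (M + 1) → Matrix (Fin n) (Fin n) ℝ}
    (φ : Matrix (Fin n) (Fin n) ℝ →ₗ[ℝ] ℝ) {c : ℝ}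
    (hφ : ∀ k : Fin M, |φ (X k.succ - X k.castSucc)| ≤ c * (g k.succ - g k.castSucc))
    {s t : ℝ} (hs : s ∈ Set.Icc (g 0) (g (Fin.last M)))
    (ht : t ∈ Set.Icc (g 0) (g (Fin.last M))) :
    |φ (gridInterp g X s) - φ (gridInterp g X t)| ≤ c * |s - t| := by
  refine abs_sub_le_of_grid (f := fun s => φ (gridInterp g X s)) hg (fun k s hs t ht => ?_) hs ht
  have hd : 0 < g k.succ - g k.castSucc := sub_pos.2 (hg k.castSucc_lt_succ)
  have h : φ (gridInterp g X s) - φ (gridInterp g X t) =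
      φ (X k.succ - X k.castSucc) / (g k.succ - g k.castSucc) * (s - t) := by
    rw [gridInterp_eq hg X k hs, gridInterp_eq hg X k ht]
    simp only [map_add, map_sub, map_smul, smul_eq_mul]
    field_simp
    ring
  simp only [h]
  rw [abs_mul, abs_div, abs_of_pos hd]
  gcongr
  rw [div_le_iff₀ hd]
  exact hφ k

/-- The cell and the weights do not depend on `X`: all agents are interpolated simultaneously, as
the coupled inequalities require. -/
theorem gridInterp_mem_segment (hM : 1 ≤ M) (hg : StrictMono g) {ρ : ℝ}
    (hρ : ρ ∈ Set.Icc (g 0) (g (Fin.last M))) :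
    ∃ k : Fin M, ∃ a b : ℝ, 0 ≤ a ∧ 0 ≤ b ∧ a + b = 1 ∧
      ρ ∈ Set.Icc (g k.castSucc) (g k.succ) ∧
      ∀ X : Fin (M + 1) → Matrix (Fin n) (Fin n) ℝ,
        gridInterp g X ρ = a • X k.castSucc + b • X k.succ := by
  obtain ⟨k, hk⟩ := exists_mem_Icc_grid hM hρ
  have hd : 0 < g k.succ - g k.castSucc := sub_pos.2 (hg k.castSucc_lt_succ)
  refine ⟨k, _, _, div_nonneg (sub_nonneg.2 hk.2) hd.le, div_nonneg (sub_nonneg.2 hk.1) hd.le, ?_,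
    hk, fun X => gridInterp_eq hg X k hk⟩
  rw [← add_div, div_eq_one_iff_eq hd.ne']
  ring

variable {X : Fin (M + 1) → Matrix (Fin n) (Fin n) ℝ}

theorem exists_le_quadForm_gridInterp (hM : 1 ≤ M) (hg : StrictMono g)
    (hX : ∀ k, (X k).PosDef) :
    ∃ a > 0, ∀ ρ ∈ Set.Icc (g 0) (g (Fin.last M)), ∀ e,
      a * normSq e ≤ e ⬝ᵥ gridInterp g X ρ *ᵥ e := by
  choose a ha h using fun k => (hX k).exists_le_quadForm
  obtain ⟨k₀, hk₀⟩ := Finite.exists_min a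
  refine ⟨a k₀, ha k₀, fun ρ hρ e => ?_⟩
  obtain ⟨k, p, q, hp, hq, hpq, -, hX'⟩ := gridInterp_mem_segment (n := n) hM hg hρ
  rw [hX' X, add_mulVec, smul_mulVec, smul_mulVec, dotProduct_add, dotProduct_smul,
    dotProduct_smul, smul_eq_mul, smul_eq_mul]
  have h0 : ∀ k, a k₀ * normSq e ≤ e ⬝ᵥ X k *ᵥ e := fun k =>
    (mul_le_mul_of_nonneg_right (hk₀ k) (normSq_nonneg e)).trans (h k e)
  calc a k₀ * normSq e = p * (a k₀ * normSq e) + q * (a k₀ * normSq e) := by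
        rw [← add_mul, hpq, one_mul]
    _ ≤ _ := by gcongr <;> exact h0 _

theorem exists_quadForm_gridInterp_le (hM : 1 ≤ M) (hg : StrictMono g)
    (X : Fin (M + 1) → Matrix (Fin n) (Fin n) ℝ) :
    ∃ b, ∀ ρ ∈ Set.Icc (g 0) (g (Fin.last M)), ∀ e,
      e ⬝ᵥ gridInterp g X ρ *ᵥ e ≤ b * normSq e := by
  obtain ⟨k₀, hk₀⟩ := Finite.exists_max fun k => specNorm (X k)
  refine ⟨specNorm (X k₀), fun ρ hρ e => ?_⟩
  obtain ⟨k, p, q, hp, hq, hpq, -, hX'⟩ := gridInterp_mem_segment (n := n) hM hg hρ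
  rw [hX' X, add_mulVec, smul_mulVec, smul_mulVec, dotProduct_add, dotProduct_smul,
    dotProduct_smul, smul_eq_mul, smul_eq_mul]
  have h0 : ∀ k, e ⬝ᵥ X k *ᵥ e ≤ specNorm (X k₀) * normSq e := fun k =>
    (le_of_abs_le (abs_quadForm_le _ e)).trans
      (mul_le_mul_of_nonneg_right (hk₀ k) (normSq_nonneg e))
  calc _ ≤ p * (specNorm (X k₀) * normSq e) + q * (specNorm (X k₀) * normSq e) := by
        gcongr <;> exact h0 _
    _ = _ := by rw [← add_mul, hpq, one_mul]

theorem gridInterp_posDef (hM : 1 ≤ M) (hg : StrictMono g) (hX : ∀ k, (X k).PosDef) {ρ : ℝ}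
    (hρ : ρ ∈ Set.Icc (g 0) (g (Fin.last M))) : (gridInterp g X ρ).PosDef := by
  obtain ⟨a, ha, h⟩ := exists_le_quadForm_gridInterp hM hg hX
  refine Matrix.PosDef.of_dotProduct_mulVec_pos ?_ fun {x} hx => ?_
  · obtain ⟨k, p, q, -, -, -, -, hX'⟩ := gridInterp_mem_segment (n := n) hM hg hρ
    rw [hX' X, IsHermitian, conjTranspose_add, conjTranspose_smul, conjTranspose_smul,
      (hX _).1.eq, (hX _).1.eq, star_trivial, star_trivial]
  · rw [star_trivial]
    exact (mul_pos ha (by simpa [normSq] using dotProduct_star_self_pos_iff.2 hx)).trans_le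
      (h ρ hρ x)

theorem exists_abs_gridInterp_apply_sub_le (hM : 1 ≤ M) (hg : StrictMono g)
    (X : Fin (M + 1) → Matrix (Fin n) (Fin n) ℝ) (a b : Fin n) :
    ∃ c, 0 ≤ c ∧ ∀ s ∈ Set.Icc (g 0) (g (Fin.last M)), ∀ t ∈ Set.Icc (g 0) (g (Fin.last M)),
      |gridInterp g X s a b - gridInterp g X t a b| ≤ c * |s - t| := by
  have : Nonempty (Fin M) := ⟨⟨0, hM⟩⟩
  let φ : Matrix (Fin n) (Fin n) ℝ →ₗ[ℝ] ℝ := Matrix.entryLinearMap ℝ ℝ a b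
  obtain ⟨k₀, hk₀⟩ := Finite.exists_max fun k : Fin M =>
    |φ (X k.succ - X k.castSucc)| / (g k.succ - g k.castSucc)
  have hd : ∀ k : Fin M, 0 < g k.succ - g k.castSucc :=
    fun k => sub_pos.2 (hg k.castSucc_lt_succ)
  have hc := div_nonneg (abs_nonneg (φ (X k₀.succ - X k₀.castSucc))) (hd k₀).le
  refine ⟨_, hc, fun s hs t ht => abs_map_gridInterp_sub_le hg φ (fun k => ?_) hs ht⟩
  rw [← div_le_iff₀ (hd k)]
  exact hk₀ k

theorem continuousOn_gridInterp (hM : 1 ≤ M) (hg : StrictMono g)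
    (X : Fin (M + 1) → Matrix (Fin n) (Fin n) ℝ) :
    ContinuousOn (gridInterp g X) (Set.Icc (g 0) (g (Fin.last M))) := by
  refine continuousOn_pi.2 fun a => continuousOn_pi.2 fun b => ?_
  obtain ⟨c, hc, h⟩ := exists_abs_gridInterp_apply_sub_le hM hg X a b
  refine LipschitzOnWith.continuousOn (K := c.toNNReal) (LipschitzOnWith.of_dist_le_mul ?_)
  intro s hs t ht
  rw [Real.dist_eq, Real.dist_eq, Real.coe_toNNReal c hc]
  exact h s hs t ht

theorem continuousOn_inv_gridInterp (hM : 1 ≤ M) (hg : StrictMono g) (hX : ∀ k, (X k).PosDef) :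
    ContinuousOn (fun ρ => (gridInterp g X ρ)⁻¹) (Set.Icc (g 0) (g (Fin.last M))) := by
  intro ρ hρ
  refine ContinuousAt.comp_continuousWithinAt (g := fun A : Matrix (Fin n) (Fin n) ℝ => A⁻¹)
    (continuousAt_matrix_inv _ ?_) (continuousOn_gridInterp hM hg X ρ hρ)
  rw [Ring.inverse_eq_inv']
  exact continuousAt_inv₀ (gridInterp_posDef hM hg hX hρ).det_pos.ne'

end Grid

/-! ### From the rate bound to the variation of the weights in time. -/

section Rate

variable {N n M : ℕ} {g : Fin (M + 1) → ℝ} {Q : Fin N → Matrix (Fin n) (Fin n) ℝ}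
  {X : Fin N → Fin (M + 1) → Matrix (Fin n) (Fin n) ℝ} {ρ : ℝ → ℝ} {η : ℝ}

theorem slope_mul_abs_derivWithin_le (hη : 0 ≤ η) (hQ : ∀ i, (Q i).PosDef)
    (hrate : supRate ρ ≤ ENNReal.ofReal η * rateBound g Q X) (hg : StrictMono g) (i : Fin N)
    (k : Fin M) {t : ℝ} (ht : 0 ≤ t) :
    specNorm (X i k.succ - X i k.castSucc) / (g k.succ - g k.castSucc) *
      |derivWithin ρ (Set.Ici 0) t| ≤ η * lambdaMin (Q i) := by
  set s := specNorm (X i k.succ - X i k.castSucc) / (g k.succ - g k.castSucc) with hs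
  have hs0 : 0 ≤ s := div_nonneg (specNorm_nonneg _) (sub_pos.2 (hg k.castSucc_lt_succ)).le
  set S := ⨆ k : Fin M, ENNReal.ofReal
      (specNorm (X i k.succ - X i k.castSucc) / (g k.succ - g k.castSucc)) with hS
  have h1 : ENNReal.ofReal |derivWithin ρ (Set.Ici 0) t| ≤
      ENNReal.ofReal η * (ENNReal.ofReal (lambdaMin (Q i)) * S⁻¹) :=
    (le_iSup₂_of_le t ht le_rfl).trans (hrate.trans (by gcongr; exact iInf_le _ i))
  have h2 : ENNReal.ofReal s ≤ S := le_iSup (fun k : Fin M => ENNReal.ofReal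
      (specNorm (X i k.succ - X i k.castSucc) / (g k.succ - g k.castSucc))) k
  have hl := (hQ i).lambdaMin_nonneg
  rw [← ENNReal.ofReal_le_ofReal_iff (mul_nonneg hη hl), ENNReal.ofReal_mul hs0,
    ENNReal.ofReal_mul hη]
  calc _ ≤ S * (ENNReal.ofReal η * (ENNReal.ofReal (lambdaMin (Q i)) * S⁻¹)) := by gcongr
    _ = ENNReal.ofReal η * ENNReal.ofReal (lambdaMin (Q i)) * (S * S⁻¹) := by ring
    -- In `[0,∞]` this holds also for `S = 0`, where `S⁻¹ = ∞`; no case distinction is needed for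
    -- weights independent of `k`.
    _ ≤ ENNReal.ofReal η * ENNReal.ofReal (lambdaMin (Q i)) * 1 := by
      gcongr; exact ENNReal.mul_inv_le_one S
    _ = _ := mul_one _

/-- The quadratic form `e ↦ e'Ae` as a linear function of `A`. -/
def quadFormLinear {n : ℕ} (e : Fin n → ℝ) : Matrix (Fin n) (Fin n) ℝ →ₗ[ℝ] ℝ where
  toFun A := e ⬝ᵥ A *ᵥ e
  map_add' A B := by rw [add_mulVec, dotProduct_add]
  map_smul' c A := by rw [smul_mulVec, dotProduct_smul]; rfl

/-- The steepest cell gives a Lipschitz constant `c` in `ρ`, and `c|dρ/dt| ≤ η λ_min(Qᵢ)` by the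
rate bound. The estimate is in terms of increments, so the corners at grid points cause no
difficulty. -/
theorem abs_quadForm_gridInterp_sub_le (hM : 1 ≤ M) (hη : 0 ≤ η) (hQ : ∀ i, (Q i).PosDef)
    (hrate : supRate ρ ≤ ENNReal.ofReal η * rateBound g Q X) (hg : StrictMono g)
    (hρ : DifferentiableOn ℝ ρ (Set.Ici 0))
    (hρg : ∀ t, 0 ≤ t → ρ t ∈ Set.Icc (g 0) (g (Fin.last M))) (i : Fin N) (e : Fin n → ℝ)
    {s t : ℝ} (hs : 0 ≤ s) (ht : 0 ≤ t) :
    |e ⬝ᵥ gridInterp g (X i) (ρ s) *ᵥ e - e ⬝ᵥ gridInterp g (X i) (ρ t) *ᵥ e| ≤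
      η * (e ⬝ᵥ Q i *ᵥ e) * |s - t| := by
  have : Nonempty (Fin M) := ⟨⟨0, hM⟩⟩
  have hd : ∀ k : Fin M, 0 < g k.succ - g k.castSucc :=
    fun k => sub_pos.2 (hg k.castSucc_lt_succ)
  obtain ⟨k₀, hk₀⟩ := Finite.exists_max fun k : Fin M =>
    specNorm (X i k.succ - X i k.castSucc) / (g k.succ - g k.castSucc)
  set c := specNorm (X i k₀.succ - X i k₀.castSucc) / (g k₀.succ - g k₀.castSucc) with hc
  have hc0 : 0 ≤ c := div_nonneg (specNorm_nonneg _) (hd k₀).le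
  have h1 : |quadFormLinear e (gridInterp g (X i) (ρ s)) -
      quadFormLinear e (gridInterp g (X i) (ρ t))| ≤ c * normSq e * |ρ s - ρ t| := by
    refine abs_map_gridInterp_sub_le hg _ (fun k => ?_)
      (hρg s hs) (hρg t ht)
    refine (abs_quadForm_le _ e).trans ?_
    have := hk₀ k
    rw [div_le_iff₀ (hd k)] at this
    have := mul_le_mul_of_nonneg_right this (normSq_nonneg e)
    linarith
  have h2 : c * |ρ s - ρ t| ≤ η * lambdaMin (Q i) * |s - t| := by
    -- The mean value inequality is applied to `c * ρ` rather than `ρ`, which avoids dividing by a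
    -- possibly vanishing `c`.
    have h := (convex_Ici (0 : ℝ)).norm_image_sub_le_of_norm_derivWithin_le
      (f := fun t => c * ρ t) (C := η * lambdaMin (Q i)) (hρ.const_mul c) (fun x hx => ?_) ht hs
    · rwa [← mul_sub, Real.norm_eq_abs, abs_mul, abs_of_nonneg hc0, Real.norm_eq_abs] at h
    · rw [derivWithin_const_mul _ (hρ x hx), Real.norm_eq_abs, abs_mul, abs_of_nonneg hc0]
      exact slope_mul_abs_derivWithin_le hη hQ hrate hg i k₀ hx
  calc _ ≤ c * normSq e * |ρ s - ρ t| := h1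
    _ = c * |ρ s - ρ t| * normSq e := by ring
    _ ≤ η * lambdaMin (Q i) * |s - t| * normSq e :=
      mul_le_mul_of_nonneg_right h2 (normSq_nonneg e)
    _ = η * (lambdaMin (Q i) * normSq e) * |s - t| := by ring
    _ ≤ η * (e ⬝ᵥ Q i *ᵥ e) * |s - t| := by
      gcongr
      exact (hQ i).1.lambdaMin_mul_normSq_le e

end Rate

/-! ### Continuity of the gains and the matrix inequalities between grid points. -/

namespace BilinearNetwork

variable {N n M : ℕ} (net : BilinearNetwork N n) {g : Fin (M + 1) → ℝ}

theorem continuousGains_gridInterp (hM : 1 ≤ M) (hg : StrictMono g) (γ : ℝ)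
    {X : Fin N → Fin (M + 1) → Matrix (Fin n) (Fin n) ℝ} (hX : ∀ i k, (X i k).PosDef)
    {Γ : Set ℝ} (hΓ : Γ ⊆ Set.Icc (g 0) (g (Fin.last M))) :
    net.ContinuousGains Γ (net.gainL γ fun i => gridInterp g (X i))
      (net.gainK γ fun i => gridInterp g (X i)) := by
  have hinv := fun i => (continuousOn_inv_gridInterp hM hg (hX i)).mono hΓ
  refine ⟨fun i => ?_, fun i j _ => ?_⟩
  · have h : Continuous fun Y : Matrix (Fin n) (Fin n) ℝ =>
        (γ ^ 2 • (Y * (net.C₂ i)ᵀ) - net.B₂ i * (net.D₂ i)ᵀ) * (net.E₂ i)⁻¹ := by fun_prop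
    exact h.comp_continuousOn (hinv i)
  · have h : Continuous fun Y : Matrix (Fin n) (Fin n) ℝ =>
        γ ^ 2 • (Y * (net.H i j)ᵀ * (net.F i j)⁻¹) := by fun_prop
    exact h.comp_continuousOn (hinv i)

theorem reducedForm_gridInterp_le (hM : 1 ≤ M) (hg : StrictMono g) {γ α : ℝ} {δ : Fin N → ℝ}
    {Q : Fin N → Matrix (Fin n) (Fin n) ℝ} {θ : Fin N → Fin (M + 1) → ℝ}
    {X : Fin N → Fin (M + 1) → Matrix (Fin n) (Fin n) ℝ}
    (hspacing : ∀ k : Fin M, |g k.castSucc - g k.succ| * specNorm net.Δ < α)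
    (hLMI : ∀ k, net.LMIFeasible γ α δ Q (g k) (fun i => θ i k) (fun i => X i k))
    {ρ : ℝ} (hρ : ρ ∈ Set.Icc (g 0) (g (Fin.last M))) (i : Fin N) (e : Fin n → ℝ)
    (w₀ : Fin net.r₀ → ℝ) (w : Fin (net.r i) → ℝ) (z : Fin N → Fin n → ℝ) :
    net.reducedForm γ δ Q ρ (fun j => gridInterp g (X j) ρ) i e w₀ w z ≤ 0 := by
  obtain ⟨k, a, b, ha, hb, hab, hk, hX⟩ := gridInterp_mem_segment (n := n) hM hg hρ
  -- Both ends of the cell are within one spacing of `ρ`, so both feasible collections can be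
  -- transported to the same `ρ` before they are averaged.
  have hdist : ∀ x, x = g k.castSucc ∨ x = g k.succ → |ρ - x| * specNorm net.Δ ≤ α := by
    intro x hx
    refine (mul_le_mul_of_nonneg_right ?_ (specNorm_nonneg _)).trans (hspacing k).le
    rw [abs_sub_comm (g k.castSucc), abs_of_nonneg (sub_nonneg.2 (hk.1.trans hk.2)), abs_le]
    rcases hx with rfl | rfl <;> constructor <;> linarith [hk.1, hk.2]
  simp only [hX, reducedForm_convexComb net γ δ Q ρ (fun j => X j k.castSucc)
    (fun j => X j k.succ) hab]
  have h1 := (hLMI k.castSucc).reducedForm_le net i ρ (hdist _ (Or.inl rfl)) e w₀ w z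
  have h2 := (hLMI k.succ).reducedForm_le net i ρ (hdist _ (Or.inr rfl)) e w₀ w z
  have := mul_nonpos_of_nonneg_of_nonpos ha h1
  have := mul_nonpos_of_nonneg_of_nonpos hb h2
  linarith

end BilinearNetwork

/-! ### Absolutely continuous functions. -/

section AbsolutelyContinuous

theorem AbsolutelyContinuousOnInterval.congr {f g : ℝ → ℝ} {a b : ℝ}
    (hf : AbsolutelyContinuousOnInterval f a b) (h : Set.EqOn f g (Set.uIcc a b)) :
    AbsolutelyContinuousOnInterval g a b := by
  rw [absolutelyContinuousOnInterval_iff] at hf ⊢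
  intro ε hε
  obtain ⟨δ, hδ, H⟩ := hf ε hε
  refine ⟨δ, hδ, fun E hE hlt => ?_⟩
  convert H E hE hlt using 1
  refine Finset.sum_congr rfl fun i hi => ?_
  rw [h (hE.1 i hi).1, h (hE.1 i hi).2]

theorem AbsolutelyContinuousOnInterval.finset_sum {ι : Type*} {f : ι → ℝ → ℝ} {a b : ℝ}
    (s : Finset ι) (hf : ∀ i ∈ s, AbsolutelyContinuousOnInterval (f i) a b) :
    AbsolutelyContinuousOnInterval (fun t => ∑ i ∈ s, f i t) a b := by
  classical
  induction s using Finset.induction_on with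
  | empty =>
    have h : LipschitzOnWith 0 (fun _ : ℝ => (0 : ℝ)) (Set.uIcc a b) :=
      (LipschitzWith.const 0).lipschitzOnWith
    simpa using h.absolutelyContinuousOnInterval
  | insert i s hi ih =>
    simp only [Finset.sum_insert hi]
    exact (hf i (Finset.mem_insert_self i s)).add
      (ih fun j hj => hf j (Finset.mem_insert_of_mem hj))

theorem AbsolutelyContinuousOnInterval.sub_le_integral {V h : ℝ → ℝ} {T : ℝ} (hT : 0 ≤ T)
    (hV : AbsolutelyContinuousOnInterval V 0 T) (hh : IntervalIntegrable h volume 0 T)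
    (hle : ∀ᵐ t, 0 < t → deriv V t ≤ h t) : V T - V 0 ≤ ∫ t in (0 : ℝ)..T, h t := by
  rw [← hV.integral_deriv_eq_sub, intervalIntegral.integral_of_le hT,
    intervalIntegral.integral_of_le hT]
  refine setIntegral_mono_on_ae hV.intervalIntegrable_deriv.1 hh.1 measurableSet_Ioc ?_
  filter_upwards [hle] with t ht htT using ht htT.1

end AbsolutelyContinuous

/-! ### Consequences of a scalar dissipation inequality. -/

section Dissipation

variable {V c ω : ℝ → ℝ} {κ : ℝ}

theorem intervalIntegrable_of_integrableOn_Ici (hω : IntegrableOn ω (Set.Ici 0)) {T : ℝ}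
    (hT : 0 ≤ T) : IntervalIntegrable ω volume 0 T :=
  (intervalIntegrable_iff_integrableOn_Ioc_of_le hT).2
    (hω.mono_set fun _ ht => ht.1.le)

/-- Integration over `[0,T]` and `V T ≥ 0` bound the integral of `c` uniformly in `T`; since `c ≥
0`, this gives integrability on the half-line as well as the estimate. -/
theorem integrableOn_and_integral_le_of_dissipation
    (hV : ∀ T, 0 ≤ T → AbsolutelyContinuousOnInterval V 0 T) (hV0 : ∀ t, 0 ≤ t → 0 ≤ V t)
    (hc : ContinuousOn c (Set.Ici 0)) (hc0 : ∀ t, 0 ≤ t → 0 ≤ c t)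
    (hω : IntegrableOn ω (Set.Ici 0)) (hω0 : ∀ t, 0 ≤ ω t)
    (hle : ∀ᵐ t, 0 < t → deriv V t ≤ ω t - c t) :
    IntegrableOn c (Set.Ici 0) ∧
      ∫ t in Set.Ici (0 : ℝ), c t ≤ V 0 + ∫ t in Set.Ici (0 : ℝ), ω t := by
  have hci : ∀ T, 0 ≤ T → IntervalIntegrable c volume 0 T := fun T hT =>
    (hc.mono (by rw [Set.uIcc_of_le hT]; exact Set.Icc_subset_Ici_self)).intervalIntegrable
  have hbound : ∀ T, 0 ≤ T → ∫ t in (0 : ℝ)..T, c t ≤ V 0 + ∫ t in Set.Ici (0 : ℝ), ω t := by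
    intro T hT
    have hωi := intervalIntegrable_of_integrableOn_Ici hω hT
    have h1 := (hV T hT).sub_le_integral hT (hωi.sub (hci T hT)) hle
    rw [intervalIntegral.integral_sub hωi (hci T hT)] at h1
    have h2 : ∫ t in (0 : ℝ)..T, ω t ≤ ∫ t in Set.Ici (0 : ℝ), ω t := by
      rw [intervalIntegral.integral_of_le hT]
      exact setIntegral_mono_set hω (ae_of_all _ hω0)
        (Set.Ioc_subset_Icc_self.trans Set.Icc_subset_Ici_self).eventuallyLE
    linarith [hV0 T hT]
  have hint : IntegrableOn c (Set.Ioi 0) := by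
    refine integrableOn_Ioi_of_intervalIntegral_norm_bounded
      (V 0 + ∫ t in Set.Ici (0 : ℝ), ω t) 0 (b := fun T : ℝ => T) (l := atTop) (fun T => ?_)
      tendsto_id ?_
    · rcases le_total 0 T with hT | hT
      · exact (hci T hT).1
      · simp [Set.Ioc_eq_empty (not_lt.2 hT)]
    · filter_upwards [eventually_ge_atTop 0] with T hT
      refine le_trans (le_of_eq ?_) (hbound T hT)
      refine intervalIntegral.integral_congr fun t ht => ?_
      rw [Set.uIcc_of_le hT] at ht
      simp only [Real.norm_eq_abs, abs_of_nonneg (hc0 t ht.1)]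
  refine ⟨(integrableOn_Ici_iff_integrableOn_Ioi (by finiteness)).2 hint, ?_⟩
  rw [integral_Ici_eq_integral_Ioi (f := c)]
  refine le_of_tendsto (intervalIntegral_tendsto_integral_Ioi 0 hint tendsto_id) ?_
  filter_upwards [eventually_ge_atTop 0] with T hT using hbound T hT

/-- Gronwall: the integrating factor `exp(-κ(T-t))` removes the term `κV` from the derivative of the
product. -/
theorem le_exp_mul_add_integral_of_dissipation
    (hV : ∀ T, 0 ≤ T → AbsolutelyContinuousOnInterval V 0 T)
    (hω : IntegrableOn ω (Set.Ici 0))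
    (hle : ∀ᵐ t, 0 < t → deriv V t ≤ ω t - κ * V t) {T : ℝ} (hT : 0 ≤ T) :
    V T ≤ Real.exp (-κ * T) * V 0 + ∫ t in (0 : ℝ)..T, Real.exp (-κ * (T - t)) * ω t := by
  have hE : ∀ t, HasDerivAt (fun t => Real.exp (-κ * (T - t))) (κ * Real.exp (-κ * (T - t))) t := by
    intro t
    have h := (((hasDerivAt_id t).const_sub T).const_mul (-κ)).exp
    simp only [id] at h
    convert h using 1
    ring
  have hEac : AbsolutelyContinuousOnInterval (fun t => Real.exp (-κ * (T - t))) 0 T := by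
    refine ContDiffOn.absolutelyContinuousOnInterval (ContDiff.contDiffOn ?_)
    fun_prop
  have hcont : Continuous fun t => Real.exp (-κ * (T - t)) := by fun_prop
  have hU := hEac.mul (hV T hT)
  have hd : ∀ᵐ t, 0 < t → t ∈ Set.uIcc 0 T →
      deriv ((fun t => Real.exp (-κ * (T - t))) * V) t ≤ Real.exp (-κ * (T - t)) * ω t := by
    filter_upwards [hle, (hV T hT).ae_differentiableAt] with t h1 h2 h3 h4
    rw [((hE t).mul (h2 h4).hasDerivAt).deriv]
    have := mul_le_mul_of_nonneg_left (h1 h3) (Real.exp_pos (-κ * (T - t))).le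
    linarith
  have hωi := (intervalIntegrable_of_integrableOn_Ici hω hT).continuousOn_mul hcont.continuousOn
  have hsub : ((fun t => Real.exp (-κ * (T - t))) * V) T -
      ((fun t => Real.exp (-κ * (T - t))) * V) 0 ≤
      ∫ t in (0 : ℝ)..T, Real.exp (-κ * (T - t)) * ω t := by
    rw [← hU.integral_deriv_eq_sub, intervalIntegral.integral_of_le hT,
      intervalIntegral.integral_of_le hT]
    refine setIntegral_mono_on_ae hU.intervalIntegrable_deriv.1 hωi.1 measurableSet_Ioc ?_
    filter_upwards [hd] with t ht htT
    exact ht htT.1 (by rw [Set.uIcc_of_le hT]; exact ⟨htT.1.le, htT.2⟩)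
  simp only [Pi.mul_apply, sub_self, mul_zero, Real.exp_zero, one_mul, sub_zero] at hsub
  linarith

/-- In the Gronwall bound the convolution of `ω` with a decaying exponential tends to zero by
dominated convergence, with `|ω|` as the dominating function. -/
theorem tendsto_zero_of_dissipation (hκ : 0 < κ)
    (hV : ∀ T, 0 ≤ T → AbsolutelyContinuousOnInterval V 0 T) (hV0 : ∀ t, 0 ≤ t → 0 ≤ V t)
    (hω : IntegrableOn ω (Set.Ici 0))
    (hle : ∀ᵐ t, 0 < t → deriv V t ≤ ω t - κ * V t) : Tendsto V atTop (𝓝 0) := by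
  have hexp : ∀ s : ℝ, Tendsto (fun T => Real.exp (-κ * (T - s))) atTop (𝓝 0) := by
    intro s
    refine Real.tendsto_exp_atBot.comp ?_
    exact (tendsto_atTop_add_const_right _ (-s) tendsto_id).const_mul_atTop_of_neg
      (neg_lt_zero.2 hκ)
  have h1 : Tendsto (fun T => Real.exp (-κ * T) * V 0) atTop (𝓝 0) := by
    simpa using (hexp 0).mul_const (V 0)
  -- The indicator moves the dependence on `T` from the domain of integration into the integrand.
  have h2 : Tendsto (fun T => ∫ t in Set.Ioi (0 : ℝ),
      (Set.Iic T).indicator (fun t => Real.exp (-κ * (T - t)) * ω t) t) atTop (𝓝 0) := by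
    have hω' : IntegrableOn ω (Set.Ioi 0) := hω.mono_set Set.Ioi_subset_Ici_self
    have := tendsto_integral_filter_of_dominated_convergence (μ := volume.restrict (Set.Ioi 0))
      (F := fun T t => (Set.Iic T).indicator (fun t => Real.exp (-κ * (T - t)) * ω t) t)
      (f := fun _ => (0 : ℝ)) (l := atTop) (fun t => ‖ω t‖) ?_ ?_ hω'.norm ?_
    · simpa using this
    · refine Eventually.of_forall fun T => AEStronglyMeasurable.indicator ?_ measurableSet_Iic
      have hcont : Continuous fun t => Real.exp (-κ * (T - t)) := by fun_prop
      exact hcont.aestronglyMeasurable.mul hω'.aestronglyMeasurable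
    · refine Eventually.of_forall fun T => ae_of_all _ fun t => ?_
      by_cases ht : t ∈ Set.Iic T
      · rw [Set.indicator_of_mem ht, norm_mul, Real.norm_eq_abs, Real.abs_exp]
        refine mul_le_of_le_one_left (norm_nonneg _) (Real.exp_le_one_iff.2 ?_)
        have : t ≤ T := ht
        nlinarith
      · rw [Set.indicator_of_notMem ht, norm_zero]
        exact norm_nonneg _
    · refine ae_of_all _ fun t => ?_
      have h := (hexp t).mul_const (ω t)
      rw [zero_mul] at h
      refine h.congr' ?_
      filter_upwards [eventually_ge_atTop t] with T hT
      rw [Set.indicator_of_mem (show t ∈ Set.Iic T from hT)]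
  have h3 := h1.add h2
  rw [add_zero] at h3
  refine tendsto_of_tendsto_of_tendsto_of_le_of_le' tendsto_const_nhds h3 ?_ ?_
  · filter_upwards [eventually_ge_atTop 0] with T hT using hV0 T hT
  · filter_upwards [eventually_ge_atTop 0] with T hT
    refine (le_exp_mul_add_integral_of_dissipation hV hω hle hT).trans_eq ?_
    rw [intervalIntegral.integral_of_le hT, setIntegral_indicator measurableSet_Iic,
      Set.Ioi_inter_Iic]

end Dissipation

/-! ### Regularity of Carathéodory solutions. -/

section SolvesIVP

variable {n : ℕ} {f h : ℝ → Fin n → ℝ} {x₀ y₀ : Fin n → ℝ} {x y : ℝ → Fin n → ℝ}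

theorem SolvesIVP.sub (hx : SolvesIVP f x₀ x) (hy : SolvesIVP h y₀ y) :
    SolvesIVP (fun t => f t - h t) (x₀ - y₀) (fun t => x t - y t) := by
  intro t ht
  obtain ⟨h1, h2⟩ := hx t ht
  obtain ⟨h3, h4⟩ := hy t ht
  refine ⟨h1.sub h3, ?_⟩
  simp only [h2, h4]
  rw [intervalIntegral.integral_sub h1 h3]
  abel

theorem SolvesIVP.initial (hx : SolvesIVP f x₀ x) : x 0 = x₀ := by
  simpa using (hx 0 le_rfl).2

theorem IntervalIntegrable.apply_fin {a b : ℝ} (hf : IntervalIntegrable f volume a b) (i : Fin n) :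
    IntervalIntegrable (fun t => f t i) volume a b :=
  ⟨Integrable.eval hf.1 i, Integrable.eval hf.2 i⟩

theorem SolvesIVP.apply_eq (hx : SolvesIVP f x₀ x) {t : ℝ} (ht : 0 ≤ t) (i : Fin n) :
    x t i = x₀ i + ∫ s in (0 : ℝ)..t, f s i := by
  obtain ⟨h1, h2⟩ := hx t ht
  rw [h2, Pi.add_apply]
  congr 1
  exact ((ContinuousLinearMap.proj (R := ℝ) (φ := fun _ : Fin n => ℝ) i).intervalIntegral_comp_comm
    h1).symm

theorem SolvesIVP.absolutelyContinuousOnInterval (hx : SolvesIVP f x₀ x) {T : ℝ} (hT : 0 ≤ T)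
    (i : Fin n) : AbsolutelyContinuousOnInterval (fun t => x t i) 0 T := by
  have h1 := ((hx T hT).1.apply_fin i).absolutelyContinuousOnInterval_intervalIntegral
    (c := 0) Set.left_mem_uIcc
  have h2 : AbsolutelyContinuousOnInterval (fun _ => x₀ i) 0 T :=
    LipschitzOnWith.absolutelyContinuousOnInterval (LipschitzWith.const (x₀ i)).lipschitzOnWith
  refine (h2.add h1).congr fun t ht => ?_
  rw [Set.uIcc_of_le hT] at ht
  simp only [Pi.add_apply, hx.apply_eq ht.1 i]

theorem SolvesIVP.continuousOn (hx : SolvesIVP f x₀ x) : ContinuousOn x (Set.Ici 0) := by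
  refine continuousOn_pi.2 fun i t ht => ?_
  have ht' : (0 : ℝ) ≤ t := ht
  have h := (hx.absolutelyContinuousOnInterval (by linarith : 0 ≤ t + 1) i).continuousOn
  rw [Set.uIcc_of_le (by linarith)] at h
  refine (h t ⟨ht, by linarith⟩).mono_of_mem_nhdsWithin ?_
  exact mem_nhdsWithin.2 ⟨Set.Iio (t + 1), isOpen_Iio, by simp, fun s hs => ⟨hs.2, hs.1.le⟩⟩

theorem SolvesIVP.ae_hasDerivAt (hx : SolvesIVP f x₀ x) :
    ∀ᵐ t, 0 < t → HasDerivAt x (f t) t := by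
  -- Lebesgue differentiation is available on bounded intervals; integer endpoints keep the union of
  -- exceptional sets countable.
  have h : ∀ᵐ t, ∀ (m : ℕ) (i : Fin n), t ∈ Set.uIcc 0 (m : ℝ) → ∀ c ∈ Set.uIcc 0 (m : ℝ),
      HasDerivAt (fun t => ∫ s in c..t, f s i) (f t i) t := by
    rw [ae_all_iff]
    intro m
    rw [ae_all_iff]
    exact fun i => ((hx m m.cast_nonneg).1.apply_fin i).ae_hasDerivAt_integral
  filter_upwards [h] with t ht ht0
  refine hasDerivAt_pi.2 fun i => ?_
  obtain ⟨m, hm⟩ := exists_nat_ge t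
  have h1 := (ht m i (by rw [Set.uIcc_of_le m.cast_nonneg]; exact ⟨ht0.le, hm⟩) 0
    Set.left_mem_uIcc).const_add (x₀ i)
  refine h1.congr_of_eventuallyEq ?_
  filter_upwards [lt_mem_nhds ht0] with s hs
  exact hx.apply_eq hs.le i

end SolvesIVP

/-! ### Derivative of a quadratic form with Lipschitz weights. -/

section Lyapunov

variable {n N : ℕ}

/-- If the matrices `Y i` are Lipschitz in the sense of quadratic forms, with the constants given
by the quadratic forms of `R i`, then the derivative of `∑ᵢ eᵢ'Yᵢeᵢ` is at most
`∑ᵢ (2 eᵢ'Yᵢ ėᵢ + eᵢ'Rᵢeᵢ)`. -/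
theorem deriv_sum_quadForm_le {e : Fin N → ℝ → Fin n → ℝ}
    {Y : Fin N → ℝ → Matrix (Fin n) (Fin n) ℝ} {R : Fin N → Matrix (Fin n) (Fin n) ℝ} {t : ℝ}
    (hY : ∀ i, (Y i t).IsHermitian) {e' : Fin N → Fin n → ℝ}
    (he : ∀ i, HasDerivAt (e i) (e' i) t)
    (hlip : ∀ i v, ∀ s > t, v ⬝ᵥ Y i s *ᵥ v - v ⬝ᵥ Y i t *ᵥ v ≤ v ⬝ᵥ R i *ᵥ v * (s - t))
    (hdiff : DifferentiableAt ℝ (fun t => ∑ i, e i t ⬝ᵥ Y i t *ᵥ e i t) t) :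
    deriv (fun t => ∑ i, e i t ⬝ᵥ Y i t *ᵥ e i t) t ≤
      ∑ i, 2 * (e i t ⬝ᵥ Y i t *ᵥ e' i) + ∑ i, e i t ⬝ᵥ R i *ᵥ e i t := by
  have hW : HasDerivAt (fun s => ∑ i, e i s ⬝ᵥ Y i t *ᵥ e i s)
      (∑ i, 2 * (e i t ⬝ᵥ Y i t *ᵥ e' i)) t := by
    refine HasDerivAt.fun_sum fun i _ => ?_
    have hea := fun a => hasDerivAt_pi.1 (he i) a
    have h : HasDerivAt (fun s => e i s ⬝ᵥ Y i t *ᵥ e i s)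
        (e' i ⬝ᵥ Y i t *ᵥ e i t + e i t ⬝ᵥ Y i t *ᵥ e' i) t := by
      have h1 : HasDerivAt (fun s => Y i t *ᵥ e i s) (Y i t *ᵥ e' i) t :=
        by
        refine hasDerivAt_pi.2 fun a => ?_
        simp only [mulVec, dotProduct]
        exact HasDerivAt.fun_sum fun b _ => (hea b).const_mul (Y i t a b)
      rw [dotProduct, dotProduct, ← Finset.sum_add_distrib]
      exact HasDerivAt.fun_sum fun a _ => (hea a).mul (hasDerivAt_pi.1 h1 a)
    rw [two_mul]
    nth_rewrite 1 [← (hY i).mulVec_dotProduct_comm]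
    rwa [dotProduct_comm _ (e' i)]
  have h1 := hdiff.hasDerivAt.tendsto_slope.mono_left (nhdsGT_le_nhdsNE t)
  have hR : Tendsto (fun s => ∑ i, e i s ⬝ᵥ R i *ᵥ e i s) (𝓝[>] t)
      (𝓝 (∑ i, e i t ⬝ᵥ R i *ᵥ e i t)) := by
    refine Tendsto.mono_left ?_ nhdsWithin_le_nhds
    refine tendsto_finsetSum _ fun i _ => ?_
    have hc : Continuous fun v : Fin n → ℝ => v ⬝ᵥ R i *ᵥ v := by fun_prop
    exact hc.continuousAt.tendsto.comp (he i).continuousAt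
  -- For `s > t` the increment splits into that of the form with weights frozen at `t` and `∑ᵢ
  -- eᵢ(s)'(Yᵢ(s) - Yᵢ(t))eᵢ(s)`, the latter at most `(s-t)∑ᵢ eᵢ(s)'Rᵢeᵢ(s)`. Right slopes are
  -- compared, so `Y` itself need not be differentiable.
  have h2 := (hW.tendsto_slope.mono_left (nhdsGT_le_nhdsNE t)).add hR
  refine le_of_tendsto_of_tendsto h1 h2 ?_
  filter_upwards [self_mem_nhdsWithin] with s hs
  have hst : 0 < s - t := sub_pos.2 hs
  rw [slope_def_field, slope_def_field, div_add' _ _ _ hst.ne']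
  gcongr
  have h3 := Finset.sum_le_sum fun i (_ : i ∈ Finset.univ) => hlip i (e i s) s hs
  rw [Finset.sum_sub_distrib, ← Finset.sum_mul] at h3
  linarith

theorem absolutelyContinuousOnInterval_sum_quadForm {e : Fin N → ℝ → Fin n → ℝ}
    {Y : Fin N → ℝ → Matrix (Fin n) (Fin n) ℝ} {T : ℝ}
    (he : ∀ i a, AbsolutelyContinuousOnInterval (fun t => e i t a) 0 T)
    (hY : ∀ i a b, AbsolutelyContinuousOnInterval (fun t => Y i t a b) 0 T) :
    AbsolutelyContinuousOnInterval (fun t => ∑ i, e i t ⬝ᵥ Y i t *ᵥ e i t) 0 T := by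
  simp only [mulVec, dotProduct]
  refine .finset_sum (f := fun i t => ∑ a, e i t a * ∑ b, Y i t a b * e i t b) _ fun i _ => ?_
  refine .finset_sum (f := fun a t => e i t a * ∑ b, Y i t a b * e i t b) _ fun a _ => ?_
  exact (he i a).fun_mul (.finset_sum (f := fun b t => Y i t a b * e i t b) _ fun b _ =>
    (hY i a b).fun_mul (he i b))

end Lyapunov

theorem IsL2.integrableOn_normSq {ι : Type*} [Fintype ι] {w : ℝ → ι → ℝ} (hw : IsL2 w) :
    IntegrableOn (fun t => normSq (w t)) (Set.Ici 0) := by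
  refine integrable_finsetSum _ fun a _ => ?_
  simpa only [sq] using (hw a).integrable_sq

/-! ### The Lyapunov function along trajectories and the synchronization properties. -/

namespace BilinearNetwork

theorem weightedNormSq_blockDiagonal_stack {N n : ℕ} (P : Fin N → Matrix (Fin n) (Fin n) ℝ)
    (z : Fin N → Fin n → ℝ) :
    weightedNormSq (blockDiagonal P) (stack z) = ∑ i, z i ⬝ᵥ P i *ᵥ z i :=
  dotProduct_blockDiagonal_mulVec P _

variable {N n : ℕ} {net : BilinearNetwork N n} {L : net.ObserverGains}
  {K : net.InterconnectionGains} {d : net.Disturbance} {x₀ : Fin n → ℝ} {xs₀ : Fin N → Fin n → ℝ}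
  {x : ℝ → Fin n → ℝ} {xs : Fin N → ℝ → Fin n → ℝ} {ρ : ℝ → ℝ}

theorem IsTrajectory.solvesIVP_error (h : net.IsTrajectory ρ L K d x₀ xs₀ x xs) (i : Fin N) :
    SolvesIVP (fun t => net.errorField L K (ρ t) (fun j => x t - xs j t) (d.w₀ t)
      (fun i => d.w i t) (fun i j => d.wbar i j t) i) (x₀ - xs₀ i) (fun t => x t - xs i t) := by
  have h1 := h.1.sub (h.2 i)
  convert h1 using 2 with t
  have hsum : ∀ j, net.H i j *ᵥ (x t - xs i t) - net.H i j *ᵥ (x t - xs j t) +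
      net.G i j *ᵥ d.wbar i j t = net.v d xs i j t - net.H i j *ᵥ xs i t := by
    intro j
    rw [v, mulVec_sub, mulVec_sub]
    abel
  have hy : net.C₂ i *ᵥ (x t - xs i t) + net.D₂ i *ᵥ d.w i t =
      net.y d x i t - net.C₂ i *ᵥ xs i t := by
    rw [y, mulVec_sub]
    abel
  simp only [errorField, u, hsum, hy, mulVec_sub (net.A (ρ t))]
  abel

/-- The weighted power `N ‖w₀‖² + ∑ᵢ (‖wᵢ‖² + ∑ⱼ ‖w_{ij}‖²)` of a disturbance. -/
def Disturbance.power (d : net.Disturbance) (t : ℝ) : ℝ :=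
  (N : ℝ) * normSq (d.w₀ t) + ∑ i, (normSq (d.w i t) + ∑ j, normSq (d.wbar i j t))

theorem Disturbance.power_nonneg (d : net.Disturbance) (t : ℝ) : 0 ≤ d.power t :=
  add_nonneg (mul_nonneg N.cast_nonneg (normSq_nonneg _)) (Finset.sum_nonneg fun _ _ =>
    add_nonneg (normSq_nonneg _) (Finset.sum_nonneg fun _ _ => normSq_nonneg _))

theorem Disturbance.InL2.integrableOn_power (hd : d.InL2) :
    IntegrableOn d.power (Set.Ici 0) :=
  (hd.1.integrableOn_normSq.const_mul _).add (integrable_finsetSum _ fun i _ =>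
    (hd.2.1 i).integrableOn_normSq.add (integrable_finsetSum _ fun j _ =>
      (hd.2.2 i j).integrableOn_normSq))

theorem Disturbance.InL2.integral_power (hd : d.InL2) :
    ∫ t in Set.Ici (0 : ℝ), d.power t =
      (N : ℝ) * l2NormSq d.w₀ + ∑ i, (l2NormSq (d.w i) + ∑ j, l2NormSq (d.wbar i j)) := by
  have h1 : ∀ i, IntegrableOn (fun t => ∑ j, normSq (d.wbar i j t)) (Set.Ici 0) := fun i =>
    integrable_finsetSum _ fun j _ => (hd.2.2 i j).integrableOn_normSq
  have h2 : ∀ i, IntegrableOn (fun t => normSq (d.w i t) + ∑ j, normSq (d.wbar i j t))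
      (Set.Ici 0) := fun i => (hd.2.1 i).integrableOn_normSq.add (h1 i)
  simp only [power, l2NormSq]
  rw [integral_add (hd.1.integrableOn_normSq.const_mul _) (integrable_finsetSum _ fun i _ => h2 i),
    integral_const_mul, integral_finsetSum _ fun i _ => h2 i]
  congr 1
  refine Finset.sum_congr rfl fun i _ => ?_
  rw [integral_add (hd.2.1 i).integrableOn_normSq (h1 i),
    integral_finsetSum _ fun j _ => (hd.2.2 i j).integrableOn_normSq]

/-- The Lyapunov function `∑ᵢ eᵢ' X_{i,ρ} eᵢ` along a trajectory. -/
def lyapunov (X : Fin N → ℝ → Matrix (Fin n) (Fin n) ℝ) (ρ : ℝ → ℝ) (x : ℝ → Fin n → ℝ)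
    (xs : Fin N → ℝ → Fin n → ℝ) (t : ℝ) : ℝ :=
  ∑ i, (x t - xs i t) ⬝ᵥ X i (ρ t) *ᵥ (x t - xs i t)

variable {X : Fin N → ℝ → Matrix (Fin n) (Fin n) ℝ}

theorem IsTrajectory.absolutelyContinuousOnInterval_lyapunov
    (h : net.IsTrajectory ρ L K d x₀ xs₀ x xs) {T : ℝ} (hT : 0 ≤ T)
    (hac : ∀ i a b, AbsolutelyContinuousOnInterval (fun t => X i (ρ t) a b) 0 T) :
    AbsolutelyContinuousOnInterval (lyapunov X ρ x xs) 0 T :=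
  absolutelyContinuousOnInterval_sum_quadForm (e := fun i t => x t - xs i t)
    (Y := fun i t => X i (ρ t))
    (fun i a => (h.solvesIVP_error i).absolutelyContinuousOnInterval hT a) hac

/-- The variation of the weights costs at most `η∑ᵢ eᵢ'Qᵢeᵢ`, which is taken out of the term `-∑ᵢ
eᵢ'Qᵢeᵢ` supplied by the matrix inequalities. -/
theorem IsTrajectory.ae_deriv_lyapunov_le {γ κ η : ℝ} {δ : Fin N → ℝ}
    {Q : Fin N → Matrix (Fin n) (Fin n) ℝ}
    (h : net.IsTrajectory ρ (net.gainL γ X) (net.gainK γ X) d x₀ xs₀ x xs)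
    (hN : (N : ℝ) ≠ 0) (hE : ∀ i, (net.E₂ i).PosDef)
    (hF : ∀ i, ∀ j ∈ net.nbrs i, (net.F i j).PosDef)
    (hκ : ∀ i, κ ≤ 2 * δ i / ((net.outDeg i : ℝ) + 1))
    (hX : ∀ t, 0 ≤ t → ∀ i, (X i (ρ t)).PosDef)
    (hred : ∀ t, 0 ≤ t → ∀ i e w₀ w z,
      net.reducedForm γ δ Q (ρ t) (fun j => X j (ρ t)) i e w₀ w z ≤ 0)
    (hlip : ∀ i v s t, 0 ≤ s → 0 ≤ t →
      |v ⬝ᵥ X i (ρ s) *ᵥ v - v ⬝ᵥ X i (ρ t) *ᵥ v| ≤ η * (v ⬝ᵥ Q i *ᵥ v) * |s - t|)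
    (hac : ∀ i a b T, 0 ≤ T → AbsolutelyContinuousOnInterval (fun t => X i (ρ t) a b) 0 T) :
    ∀ᵐ t, 0 < t → deriv (lyapunov X ρ x xs) t ≤
      γ ^ 2 * d.power t - (N : ℝ) * net.disagreement (fun i => x t - xs i t)
      - (1 - η) * ∑ i, (x t - xs i t) ⬝ᵥ Q i *ᵥ (x t - xs i t)
      - κ * lyapunov X ρ x xs t := by
  have hdiff : ∀ᵐ t, ∀ m : ℕ, t ∈ Set.uIcc 0 (m : ℝ) →
      DifferentiableAt ℝ (lyapunov X ρ x xs) t :=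
    ae_all_iff.2 fun m => (h.absolutelyContinuousOnInterval_lyapunov m.cast_nonneg
      fun i a b => hac i a b m m.cast_nonneg).ae_differentiableAt
  filter_upwards [hdiff, ae_all_iff.2 fun i => (h.solvesIVP_error i).ae_hasDerivAt]
    with t ht he ht0
  obtain ⟨m, hm⟩ := exists_nat_ge t
  have h1 := deriv_sum_quadForm_le (Y := fun i t => X i (ρ t)) (R := fun i => η • Q i)
    (fun i => (hX t ht0.le i).1) (fun i => he i ht0) (fun i v s hs => ?_)
    (ht m (by rw [Set.uIcc_of_le m.cast_nonneg]; exact ⟨ht0.le, hm⟩))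
  · have h2 := net.sum_two_mul_dotProduct_errorField_le hN hE hF hκ (hX t ht0.le)
      (hred t ht0.le) (fun i => x t - xs i t) (d.w₀ t) (fun i => d.w i t)
      (fun i j => d.wbar i j t)
    refine h1.trans ?_
    simp only [smul_mulVec, dotProduct_smul, smul_eq_mul, ← Finset.mul_sum, Disturbance.power,
      lyapunov] at h2 ⊢
    linarith
  · have h3 := (le_abs_self _).trans (hlip i v s t (ht0.trans hs).le ht0.le)
    rw [abs_of_pos (sub_pos.2 hs)] at h3
    simpa only [smul_mulVec, dotProduct_smul, smul_eq_mul] using h3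

/-- All three properties are read off the dissipation inequality. The value `η = 1` is allowed, so
that both problems are covered. -/
theorem solvesStrongSync_of_reducedForm_le {Γ : Set ℝ} {γ η a b : ℝ} {δ : Fin N → ℝ}
    {Q : Fin N → Matrix (Fin n) (Fin n) ℝ} (hN : N ≠ 0) (hγ : 0 < γ) (hη : η ≤ 1)
    (hδ : ∀ i, 0 < δ i) (hQ : ∀ i, (Q i).PosDef) (hE : ∀ i, (net.E₂ i).PosDef)
    (hF : ∀ i, ∀ j ∈ net.nbrs i, (net.F i j).PosDef)
    (hcont : net.ContinuousGains Γ (net.gainL γ X) (net.gainK γ X))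
    (hX : ∀ t, 0 ≤ t → ∀ i, (X i (ρ t)).PosDef) (ha : 0 < a)
    (hbelow : ∀ t, 0 ≤ t → ∀ i e, a * normSq e ≤ e ⬝ᵥ X i (ρ t) *ᵥ e)
    (habove : ∀ i e, e ⬝ᵥ X i (ρ 0) *ᵥ e ≤ b * normSq e)
    (hred : ∀ t, 0 ≤ t → ∀ i e w₀ w z,
      net.reducedForm γ δ Q (ρ t) (fun j => X j (ρ t)) i e w₀ w z ≤ 0)
    (hlip : ∀ i v s t, 0 ≤ s → 0 ≤ t →
      |v ⬝ᵥ X i (ρ s) *ᵥ v - v ⬝ᵥ X i (ρ t) *ᵥ v| ≤ η * (v ⬝ᵥ Q i *ᵥ v) * |s - t|)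
    (hac : ∀ i a b T, 0 ≤ T → AbsolutelyContinuousOnInterval (fun t => X i (ρ t) a b) 0 T) :
    net.SolvesStrongSync Γ ρ (net.gainL γ X) (net.gainK γ X) γ ((1 - η) • blockDiagonal Q)
      (blockDiagonal fun i => (1 / (γ ^ 2 * (N : ℝ))) • X i (ρ 0)) := by
  have hN' : (0 : ℝ) < N := by exact_mod_cast Nat.pos_of_ne_zero hN
  have : Nonempty (Fin N) := ⟨⟨0, Nat.pos_of_ne_zero hN⟩⟩
  obtain ⟨κ, hκ0, hκ⟩ : ∃ κ > 0, ∀ i, κ ≤ 2 * δ i / ((net.outDeg i : ℝ) + 1) := by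
    obtain ⟨i, hi⟩ := Finite.exists_min fun i => 2 * δ i / ((net.outDeg i : ℝ) + 1)
    have := hδ i
    exact ⟨_, by positivity, hi⟩
  have hV0 : ∀ x xs t, 0 ≤ t → 0 ≤ lyapunov X ρ x xs t := fun x xs t ht =>
    Finset.sum_nonneg fun i _ => (hX t ht i).quadForm_nonneg _
  have hVa : ∀ x xs t, 0 ≤ t → a * ∑ i, normSq (x t - xs i t) ≤ lyapunov X ρ x xs t := by
    intro x xs t ht
    rw [Finset.mul_sum]
    exact Finset.sum_le_sum fun i _ => hbelow t ht i _
  have hQ0 : ∀ e : Fin N → Fin n → ℝ, 0 ≤ (1 - η) * ∑ i, e i ⬝ᵥ Q i *ᵥ e i := fun e =>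
    mul_nonneg (by linarith) (Finset.sum_nonneg fun i _ => (hQ i).quadForm_nonneg _)
  have hdecay : ∀ d x₀ xs₀ x xs,
      net.IsTrajectory ρ (net.gainL γ X) (net.gainK γ X) d x₀ xs₀ x xs →
      ∀ᵐ t, 0 < t → deriv (lyapunov X ρ x xs) t ≤
        γ ^ 2 * d.power t - κ * lyapunov X ρ x xs t := by
    intro d x₀ xs₀ x xs h
    filter_upwards [h.ae_deriv_lyapunov_le hN'.ne' hE hF hκ hX hred hlip hac] with t ht ht0
    have h1 := ht ht0
    have h2 := mul_nonneg hN'.le (net.disagreement_nonneg fun i => x t - xs i t)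
    have h3 := hQ0 fun i => x t - xs i t
    linarith
  refine ⟨.blockDiagonal fun i => (hX 0 le_rfl i).smul (by positivity), hcont, ?_, ?_, ?_⟩
  -- The quotient of the upper bound at time `0` and the uniform lower bound of `V`; `|b| + 1` makes
  -- the constant positive whatever the sign of `b`.
  · refine ⟨(|b| + 1) / a, by positivity, κ, hκ0, fun x₀ xs₀ x xs h i t ht => ?_⟩
    have hV := fun T (hT : (0 : ℝ) ≤ T) =>
      h.absolutelyContinuousOnInterval_lyapunov hT fun i a b => hac i a b T hT
    have hpow : ∀ t, net.noDisturbance.power t = 0 := fun t => by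
      simp [Disturbance.power, noDisturbance, normSq, dotProduct]
    have h1 := le_exp_mul_add_integral_of_dissipation (ω := fun _ => 0) (κ := κ) hV
      integrableOn_zero ?_ ht
    · simp only [mul_zero, intervalIntegral.integral_zero, add_zero] at h1
      have h2 : lyapunov X ρ x xs 0 ≤ (|b| + 1) * ∑ j, normSq (x₀ - xs₀ j) := by
        rw [lyapunov, Finset.mul_sum]
        refine Finset.sum_le_sum fun j _ => ?_
        rw [(h.solvesIVP_error j).initial]
        refine (habove j _).trans (mul_le_mul_of_nonneg_right ?_ (normSq_nonneg _))
        linarith [le_abs_self b]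
      have h3 : normSq (x t - xs i t) ≤ ∑ j, normSq (x t - xs j t) :=
        Finset.single_le_sum (f := fun j => normSq (x t - xs j t))
          (fun j _ => normSq_nonneg _) (Finset.mem_univ i)
      rw [div_mul_eq_mul_div, div_mul_eq_mul_div, le_div_iff₀ ha]
      calc normSq (x t - xs i t) * a ≤ a * ∑ j, normSq (x t - xs j t) := by
            rw [mul_comm]; gcongr
        _ ≤ _ := hVa x xs t ht
        _ ≤ _ := h1
        _ ≤ Real.exp (-κ * t) * ((|b| + 1) * ∑ j, normSq (x₀ - xs₀ j)) := by gcongr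
        _ = _ := mul_comm _ _
    · filter_upwards [hdecay _ _ _ _ _ h] with t ht ht0
      have := ht ht0
      rwa [hpow, mul_zero] at this
  · intro d x₀ xs₀ x xs hd h
    have hV := fun T (hT : (0 : ℝ) ≤ T) =>
      h.absolutelyContinuousOnInterval_lyapunov hT fun i a b => hac i a b T hT
    set cost := fun e : Fin N → Fin n → ℝ => (1 / (N : ℝ)) *
      weightedNormSq ((1 - η) • blockDiagonal Q) (stack e) + net.disagreement e with hcost
    have hNcost : ∀ e, (N : ℝ) * cost e =
        (1 - η) * ∑ i, e i ⬝ᵥ Q i *ᵥ e i + (N : ℝ) * net.disagreement e := by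
      intro e
      rw [← weightedNormSq_blockDiagonal_stack, hcost]
      simp only [weightedNormSq, smul_mulVec, dotProduct_smul, smul_eq_mul, mul_add]
      rw [← mul_assoc, mul_one_div_cancel hN'.ne', one_mul]
    have hcostcont : Continuous fun e => (N : ℝ) * cost e := by
      simp only [hNcost, disagreement, normSq]
      fun_prop
    have hNdiss := integrableOn_and_integral_le_of_dissipation
      (c := fun t => (N : ℝ) * cost fun i => x t - xs i t)
      (ω := fun t => γ ^ 2 * d.power t) hV (hV0 x xs)
      (hcostcont.comp_continuousOn
        (continuousOn_pi.2 fun i => (h.solvesIVP_error i).continuousOn))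
      (fun t _ => by
        rw [hNcost]
        exact add_nonneg (hQ0 _) (mul_nonneg hN'.le (net.disagreement_nonneg _)))
      (hd.integrableOn_power.const_mul _)
      (fun t => mul_nonneg (sq_nonneg γ) (d.power_nonneg t)) ?_
    · obtain ⟨hint, hle⟩ := hNdiss
      have hint' : IntegrableOn (fun t => cost fun i => x t - xs i t) (Set.Ici 0) := by
        have := hint.const_mul (1 / (N : ℝ))
        simp only [← mul_assoc, one_div_mul_cancel hN'.ne', one_mul] at this
        exact this
      refine ⟨hint', fun hne => ?_⟩
      -- This identity is the reason for the factor `1/(γ²N)` in `P`.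
      have hVin : lyapunov X ρ x xs 0 = γ ^ 2 * N * weightedNormSq
          (blockDiagonal fun i => (1 / (γ ^ 2 * (N : ℝ))) • X i (ρ 0))
          (stack fun i => x₀ - xs₀ i) := by
        rw [weightedNormSq_blockDiagonal_stack, lyapunov, Finset.mul_sum]
        refine Finset.sum_congr rfl fun i _ => ?_
        rw [(h.solvesIVP_error i).initial, smul_mulVec, dotProduct_smul, smul_eq_mul]
        field_simp
      rw [integral_const_mul, integral_const_mul, hd.integral_power, hVin] at hle
      set P := blockDiagonal fun i => (1 / (γ ^ 2 * (N : ℝ))) • X i (ρ 0) with hP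
      have hnonneg : 0 ≤ net.inputNormSq P d x₀ xs₀ := by
        have hl2 : ∀ {m : ℕ} (w : ℝ → Fin m → ℝ), 0 ≤ l2NormSq w := fun w =>
          integral_nonneg fun t => normSq_nonneg _
        refine add_nonneg (add_nonneg ?_ (hl2 _)) (mul_nonneg (by positivity)
          (Finset.sum_nonneg fun i _ => add_nonneg (hl2 _) (Finset.sum_nonneg fun j _ => hl2 _)))
        exact (Matrix.PosDef.blockDiagonal fun i =>
          (hX 0 le_rfl i).smul (by positivity)).quadForm_nonneg _
      rw [div_le_iff₀ (lt_of_le_of_ne hnonneg hne.symm)]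
      refine le_of_mul_le_mul_left (hle.trans_eq ?_) hN'
      rw [inputNormSq]
      field_simp
      ring
    · filter_upwards [h.ae_deriv_lyapunov_le hN'.ne' hE hF hκ hX hred hlip hac] with t ht ht0
      have h1 := ht ht0
      have h2 := mul_nonneg hκ0.le (hV0 x xs t ht0.le)
      rw [hNcost]
      linarith
  · intro d x₀ xs₀ x xs hd h
    have hV := fun T (hT : (0 : ℝ) ≤ T) =>
      h.absolutelyContinuousOnInterval_lyapunov hT fun i a b => hac i a b T hT
    have h1 := (tendsto_zero_of_dissipation hκ0 hV (hV0 x xs)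
      (hd.integrableOn_power.const_mul (γ ^ 2)) (hdecay _ _ _ _ _ h)).const_mul a⁻¹
    rw [mul_zero] at h1
    refine tendsto_of_tendsto_of_tendsto_of_le_of_le' tendsto_const_nhds h1
      (Eventually.of_forall fun t => Finset.sum_nonneg fun i _ => normSq_nonneg _) ?_
    filter_upwards [eventually_ge_atTop 0] with t ht
    rw [inv_mul_eq_div, le_div_iff₀ ha, mul_comm]
    exact hVa x xs t ht

end BilinearNetwork

/-! ### Assembly of the main theorem. -/

theorem absolutelyContinuousOnInterval_gridInterp_comp {n M : ℕ} (hM : 1 ≤ M)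
    {g : Fin (M + 1) → ℝ} (hg : StrictMono g) (X : Fin (M + 1) → Matrix (Fin n) (Fin n) ℝ)
    {ρ : ℝ → ℝ} (hρ : ContDiffOn ℝ 1 ρ (Set.Ici 0))
    (hρg : ∀ t, 0 ≤ t → ρ t ∈ Set.Icc (g 0) (g (Fin.last M))) (a b : Fin n) {T : ℝ} (hT : 0 ≤ T) :
    AbsolutelyContinuousOnInterval (fun t => gridInterp g X (ρ t) a b) 0 T := by
  obtain ⟨c, hc, h⟩ := exists_abs_gridInterp_apply_sub_le hM hg X a b
  obtain ⟨K, hK⟩ := (hρ.mono (Set.Icc_subset_Ici_self : Set.Icc 0 T ⊆ _)).exists_lipschitzOnWith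
    one_ne_zero (convex_Icc _ _) isCompact_Icc
  refine LipschitzOnWith.absolutelyContinuousOnInterval (K := c.toNNReal * K)
    (LipschitzOnWith.of_dist_le_mul fun s hs t ht => ?_)
  rw [Set.uIcc_of_le hT] at hs ht
  have h1 := hK.dist_le_mul s hs t ht
  rw [Real.dist_eq, NNReal.coe_mul, Real.coe_toNNReal c hc]
  calc _ ≤ c * |ρ s - ρ t| := h _ (hρg s hs.1) _ (hρg t ht.1)
    _ ≤ c * (K * dist s t) := by gcongr; exact h1
    _ = _ := by ring

end

theorem theorem3 {N n M : ℕ} (hM : 1 ≤ M)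
    (net : BilinearNetwork N n)
    -- the graph has no self-loops and is weakly connected
    (hloop : ∀ i, ¬ net.graph.Adj i i)
    (hconn : net.graph.toSimpleGraphInclusive.Connected)
    (hE : ∀ i, (net.E₂ i).PosDef)
    (hF : ∀ i, ∀ j ∈ net.nbrs i, (net.F i j).PosDef)
    -- the scheduling signal
    (ρmin ρmax : ℝ) (ρ : ℝ → ℝ)
    (hρ : ContDiffOn ℝ 1 ρ (Set.Ici 0))
    (hρΓ : ∀ t, 0 ≤ t → ρ t ∈ Set.Icc ρmin ρmax)
    -- the design parameters
    (γ α : ℝ) (hγ : 0 < γ) (hα : 0 < α)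
    (δ : Fin N → ℝ) (hδ : ∀ i, 0 < δ i)
    (Q : Fin N → Matrix (Fin n) (Fin n) ℝ) (hQ : ∀ i, (Q i).PosDef)
    -- the grid points, with spacing below `α / σ(Δ)` (no restriction if `σ(Δ) = 0`)
    (g : Fin (M + 1) → ℝ) (hg : StrictMono g)
    (hg_min : g 0 ≤ ρmin) (hg_max : ρmax ≤ g (Fin.last M))
    (hspacing : ∀ k : Fin M, |g k.castSucc - g k.succ| * specNorm net.Δ < α)
    -- feasible solutions of the coupled matrix inequalities at the grid points
    (θ : Fin N → Fin (M + 1) → ℝ) (X : Fin N → Fin (M + 1) → Matrix (Fin n) (Fin n) ℝ)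
    (hLMI : ∀ k, net.LMIFeasible γ α δ Q (g k) (fun i => θ i k) (fun i => X i k)) :
    (supRate ρ ≤ rateBound g Q X →
      net.SolvesWeakSync (Set.Icc ρmin ρmax) ρ
        (net.gainL γ fun i => gridInterp g (X i)) (net.gainK γ fun i => gridInterp g (X i)) γ
        (blockDiagonal fun i => (1 / (γ ^ 2 * (N : ℝ))) • gridInterp g (X i) (ρ 0))) ∧
    (∀ η : ℝ, 0 ≤ η → η < 1 → supRate ρ ≤ ENNReal.ofReal η * rateBound g Q X →
      net.SolvesStrongSync (Set.Icc ρmin ρmax) ρ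
        (net.gainL γ fun i => gridInterp g (X i)) (net.gainK γ fun i => gridInterp g (X i)) γ
        ((1 - η) • blockDiagonal Q)
        (blockDiagonal fun i => (1 / (γ ^ 2 * (N : ℝ))) • gridInterp g (X i) (ρ 0))) := by
  have hρg : ∀ t, 0 ≤ t → ρ t ∈ Set.Icc (g 0) (g (Fin.last M)) := fun t ht =>
    ⟨hg_min.trans (hρΓ t ht).1, (hρΓ t ht).2.trans hg_max⟩
  have hN : N ≠ 0 := by
    rintro rfl
    exact hconn.nonempty.elim fun i => i.elim0
  have : Nonempty (Fin N) := ⟨⟨0, Nat.pos_of_ne_zero hN⟩⟩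
  have hXpos : ∀ i k, (X i k).PosDef := fun i k => (hLMI k i).2.1
  choose a ha hbelow using fun i => exists_le_quadForm_gridInterp hM hg (hXpos i)
  choose b habove using fun i => exists_quadForm_gridInterp_le hM hg (X i)
  obtain ⟨i₀, hi₀⟩ := Finite.exists_min a
  obtain ⟨i₁, hi₁⟩ := Finite.exists_max b
  have main : ∀ η : ℝ, 0 ≤ η → η ≤ 1 → supRate ρ ≤ ENNReal.ofReal η * rateBound g Q X →
      net.SolvesStrongSync (Set.Icc ρmin ρmax) ρ
        (net.gainL γ fun i => gridInterp g (X i)) (net.gainK γ fun i => gridInterp g (X i)) γ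
        ((1 - η) • blockDiagonal Q)
        (blockDiagonal fun i => (1 / (γ ^ 2 * (N : ℝ))) • gridInterp g (X i) (ρ 0)) :=
    fun η hη hη1 hrate => BilinearNetwork.solvesStrongSync_of_reducedForm_le hN hγ hη1 hδ hQ hE hF
      (net.continuousGains_gridInterp hM hg γ hXpos (Set.Icc_subset_Icc hg_min hg_max))
      (fun t ht i => gridInterp_posDef hM hg (hXpos i) (hρg t ht)) (ha i₀)
      (fun t ht i e => (mul_le_mul_of_nonneg_right (hi₀ i) (normSq_nonneg e)).trans
        (hbelow i _ (hρg t ht) e))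
      (fun i e => (habove i _ (hρg 0 le_rfl) e).trans
        (mul_le_mul_of_nonneg_right (hi₁ i) (normSq_nonneg e)))
      (fun t ht => net.reducedForm_gridInterp_le hM hg hspacing hLMI (hρg t ht))
      (fun i v s t hs ht => abs_quadForm_gridInterp_sub_le hM hη hQ hrate hg
        (hρ.differentiableOn one_ne_zero) hρg i v hs ht)
      (fun i a b T hT => absolutelyContinuousOnInterval_gridInterp_comp hM hg (X i) hρ hρg a b hT)
  refine ⟨fun hrate => ?_, fun η hη hη1 hrate => main η hη hη1.le hrate⟩
  -- At `η = 1` the weight `(1-η)Q` vanishes and the strong cost reduces to the disagreement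
  -- function.
  have h := main 1 zero_le_one le_rfl (by rwa [ENNReal.ofReal_one, one_mul])
  simp only [BilinearNetwork.SolvesStrongSync, sub_self, zero_smul,
    BilinearNetwork.weightedNormSq, zero_mulVec,
    dotProduct_zero, mul_zero, zero_add] at h
  exact h
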